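/- Let $D\subset\mathbb R^d$ be a bounded Lipschitz domain (open, connected, non-empty) and let $g$ be a Gaussian random field on $\overline D$, on a probability space $(\Omega,\mathcal F,P)$, with almost surely continuous sample paths on $\overline D$ and arbitrary mean. Write $C(x,y)=\operatorname{Cov}(g(x,\cdot),g(y,\cdot))$, and let $(\lambda_m,b_m)_{m\ge1}$ be the eigenpairs of the covariance operator: $$\int_D C(x,y)\,b_m(y)\,dy=\lambda_m b_m(x)\quad(x\in D),$$ where $(b_m)$ is orthonormal in $L^2(D)$ and all non-zero eigenvalues are listed with multiplicity. Let $\xi_m=\lambda_m^{-1/2}\int_D (g(y,\cdot)-\mathbb E[g(y,\cdot)])\,b_m(y)\,dy$ (for $\lambda_m>0$) be the coefficients of the Karhunen–Loève expansion of $g$, and for $M\in\mathbb N$ let $$g_M(x,\omega)=\mathbb E[g(x,\cdot)]+\sum_{m=1}^{M}\sqrt{\lambda_m}\,\xi_m(\omega)\,b_m(x)$$ be its truncation after $M$ terms. Assume: - (B1) every $b_m$ is continuously differentiable in $D$ and continuous on $\overline D$; - (B2) $\sum_{m\ge1}\lambda_m\|b_m\|_{L^\infty(D)}^2<\infty$;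 - (B3) there is a $\beta_0\in(0,1)$ with $\sum_{m\ge1}\lambda_m\|b_m\|_{L^\infty(D)}^{2(1-\beta_0)}\|\nabla b_m\|_{L^\infty(D)}^{2\beta_0}<\infty$. Let $a:\mathbb R\to\mathbb R$ be Lipschitz continuous with constant $K\ge0$. For $\varphi>0$ put $$a_\varphi(x,\omega)=\varphi\,\frac{e^{g(x,\omega)}}{1+e^{g(x,\omega)}}+a(g(x,\omega)),\qquad a_{\varphi,M}(x,\omega)=\varphi\,\frac{e^{g_M(x,\omega)}}{1+e^{g_M(x,\omega)}}+a(g_M(x,\omega)),$$ and for $\beta\in(0,1)$ put $$R_M^\beta=\max\Big(\sum_{m>M}\lambda_m\|b_m\|_{L^\infty(D)}^2,\ \sum_{m>M}\lambda_m\|b_m\|_{L^\infty(D)}^{2(1-\beta)}\|\nabla b_m\|_{L^\infty(D)}^{2\beta}\Big)\in[0,\infty].$$ Then for all $\varphi>0$, $p>0$ and $\beta\in(0,1)$ there is a constant $c\geq 0$, not depending on $M$, such that for every $M\in\mathbb N$ the function $\omega\mapsto\|a_{\varphi,M}(\cdot,\omega)-a_\varphi(\cdot,\omega)\|_{\mathcal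 C^0(\overline D)}$ is $P$-almost everywhere measurable and $$\|a_{\varphi,M}-a_\varphi\|_{L^p(\Omega;\,\mathcal C^0(\overline D))}=\Big(\mathbb E\Big[\sup_{x\in\overline D}|a_{\varphi,M}(x,\cdot)-a_\varphi(x,\cdot)|^p\Big]\Big)^{1/p}\le c\,(R_M^\beta)^{1/2}.$$ (The bound is trivial if $R_M^\beta=\infty$; it is finite in particular for any $\beta$ for which the series in (B3) converges.) -/

import Mathlib

open MeasureTheory ProbabilityTheory
open scoped NNReal ENNReal

noncomputable section

namespace KLField

/-- Bounded Lipschitz domain in `ℝ^d`: a nonempty, connected, bounded open set which, near each of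
its boundary points, is the strict epigraph (in a direction `ν`) of a Lipschitz function `γ` of the
component of the variable orthogonal to `ν`. -/
structure IsLipschitzDomain {d : ℕ} (D : Set (EuclideanSpace ℝ (Fin d))) : Prop where
  isOpen : IsOpen D
  isConnected : IsConnected D
  isBounded : Bornology.IsBounded D
  lipschitz_boundary : ∀ x₀ ∈ frontier D,
    ∃ (ν : EuclideanSpace ℝ (Fin d)) (γ : EuclideanSpace ℝ (Fin d) → ℝ) (L : ℝ≥0) (r : ℝ),
      ‖ν‖ = 1 ∧ LipschitzWith L γ ∧ 0 < r ∧
      ∀ x ∈ Metric.ball x₀ r, x ∈ D ↔ γ (x - inner ℝ ν x • ν) < inner ℝ ν x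

variable {d : ℕ} {Ω : Type*} [MeasurableSpace Ω]

/-- A Gaussian random field on `closure D` whose sample paths are almost surely continuous on
`closure D`. The mean function is arbitrary. -/
structure IsContinuousGaussianField (D : Set (EuclideanSpace ℝ (Fin d)))
    (g : EuclideanSpace ℝ (Fin d) → Ω → ℝ) (P : Measure Ω) : Prop where
  gaussian : IsGaussianProcess (fun x : closure D => g x) P
  continuous_paths : ∀ᵐ ω ∂P, ContinuousOn (fun x => g x ω) (closure D)

/-- The mean function `x ↦ E[g(x, ·)]`. -/
def mean (g : EuclideanSpace ℝ (Fin d) → Ω → ℝ) (P : Measure Ω)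
    (x : EuclideanSpace ℝ (Fin d)) : ℝ :=
  ∫ ω, g x ω ∂P

/-- The covariance operator `(T f)(x) = ∫_D C(x, y) f(y) dy`, where `C(x, y)` is the covariance of
`g(x, ·)` and `g(y, ·)`. -/
def covOp (D : Set (EuclideanSpace ℝ (Fin d))) (g : EuclideanSpace ℝ (Fin d) → Ω → ℝ)
    (P : Measure Ω) (f : EuclideanSpace ℝ (Fin d) → ℝ) (x : EuclideanSpace ℝ (Fin d)) : ℝ :=
  ∫ y in D, cov[g x, g y; P] * f y

/-- `(lam m, b m)`, `m = 0, 1, 2, …`, is a full sequence of eigenpairs of the covariance operator of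
`g`: the `b m` are `L²(D)`-orthonormal eigenfunctions with eigenvalues `lam m`, and the sequence
exhausts all nonzero eigenvalues with multiplicity, i.e. there is no further eigenfunction to a
nonzero eigenvalue that is orthogonal to all the `b m`. (Eigenvalue `0` may or may not be listed.) -/
structure IsKLEigensystem (D : Set (EuclideanSpace ℝ (Fin d)))
    (g : EuclideanSpace ℝ (Fin d) → Ω → ℝ) (P : Measure Ω)
    (lam : ℕ → ℝ) (b : ℕ → EuclideanSpace ℝ (Fin d) → ℝ) : Prop where
  memLp : ∀ m, MemLp (b m) 2 (volume.restrict D)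
  orthonormal : ∀ m n, ∫ x in D, b m x * b n x = if m = n then 1 else 0
  eigen : ∀ m, ∀ x ∈ D, covOp D g P (b m) x = lam m * b m x
  exhaustive : ∀ (μ : ℝ) (f : EuclideanSpace ℝ (Fin d) → ℝ), μ ≠ 0 →
    MemLp f 2 (volume.restrict D) →
    (∀ᵐ x ∂volume.restrict D, covOp D g P f x = μ * f x) →
    (∀ m, ∫ x in D, f x * b m x = 0) →
    f =ᵐ[volume.restrict D] 0

/-- The random coefficients `ξ_m = λ_m^{-1/2} ∫_D (g(y, ·) - E[g(y, ·)]) b_m(y) dy` of the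
Karhunen–Loève expansion. (Only relevant for `λ_m > 0`: the expansion uses `√λ_m ξ_m`.) -/
def klCoeff (D : Set (EuclideanSpace ℝ (Fin d))) (g : EuclideanSpace ℝ (Fin d) → Ω → ℝ)
    (P : Measure Ω) (lam : ℕ → ℝ) (b : ℕ → EuclideanSpace ℝ (Fin d) → ℝ) (m : ℕ) (ω : Ω) : ℝ :=
  (√(lam m))⁻¹ * ∫ y in D, (g y ω - mean g P y) * b m y

/-- The Karhunen–Loève expansion of `g` truncated after `M` terms:
`g_M = E[g] + ∑ √λ_m ξ_m b_m`, the sum running over the first `M` eigenpairs. -/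
def klTrunc (D : Set (EuclideanSpace ℝ (Fin d))) (g : EuclideanSpace ℝ (Fin d) → Ω → ℝ)
    (P : Measure Ω) (lam : ℕ → ℝ) (b : ℕ → EuclideanSpace ℝ (Fin d) → ℝ) (M : ℕ)
    (x : EuclideanSpace ℝ (Fin d)) (ω : Ω) : ℝ :=
  mean g P x + ∑ m ∈ Finset.range M, √(lam m) * klCoeff D g P lam b m ω * b m x

/-- The scalar transformation `t ↦ φ e^t / (1 + e^t) + a(t)`. -/
def transform (φ : ℝ) (a : ℝ → ℝ) (t : ℝ) : ℝ :=
  φ * (Real.exp t / (1 + Real.exp t)) + a t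

/-- `‖b‖_{L^∞(D)}`. -/
def supNorm (D : Set (EuclideanSpace ℝ (Fin d))) (b : EuclideanSpace ℝ (Fin d) → ℝ) : ℝ≥0∞ :=
  eLpNorm b ⊤ (volume.restrict D)

/-- `‖∇b‖_{L^∞(D)}`, with the Euclidean norm of the gradient. -/
def gradSupNorm (D : Set (EuclideanSpace ℝ (Fin d))) (b : EuclideanSpace ℝ (Fin d) → ℝ) : ℝ≥0∞ :=
  eLpNorm (gradient b) ⊤ (volume.restrict D)

/-- The term `λ_m ‖b_m‖_∞²`. -/
def supTerm (D : Set (EuclideanSpace ℝ (Fin d))) (lam : ℕ → ℝ)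
    (b : ℕ → EuclideanSpace ℝ (Fin d) → ℝ) (m : ℕ) : ℝ≥0∞ :=
  ENNReal.ofReal (lam m) * supNorm D (b m) ^ 2

/-- The term `λ_m ‖b_m‖_∞^{2(1-β)} ‖∇b_m‖_∞^{2β}`. -/
def mixedTerm (D : Set (EuclideanSpace ℝ (Fin d))) (lam : ℕ → ℝ)
    (b : ℕ → EuclideanSpace ℝ (Fin d) → ℝ) (β : ℝ) (m : ℕ) : ℝ≥0∞ :=
  ENNReal.ofReal (lam m) * supNorm D (b m) ^ (2 * (1 - β)) * gradSupNorm D (b m) ^ (2 * β)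

/-- `R_M^β`: the larger of the two tail sums over all but the first `M` eigenpairs; it is `∞` if one
of the two series diverges. -/
def tailMax (D : Set (EuclideanSpace ℝ (Fin d))) (lam : ℕ → ℝ)
    (b : ℕ → EuclideanSpace ℝ (Fin d) → ℝ) (β : ℝ) (M : ℕ) : ℝ≥0∞ :=
  max (∑' m, supTerm D lam b (m + M)) (∑' m, mixedTerm D lam b β (m + M))

/-- The norm `‖f‖_{C⁰(S)} = sup_{x ∈ S} |f(x)|`. -/
def cZeroNorm (S : Set (EuclideanSpace ℝ (Fin d))) (f : EuclideanSpace ℝ (Fin d) → ℝ) : ℝ≥0∞ :=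
  ⨆ x ∈ S, ‖f x‖ₑ

/-- The (quasi-)norm of `L^p(Ω; C⁰(S))`: `E[‖F(·, ω)‖_{C⁰(S)}^p]^{1/p}`. -/
def lpCZeroNorm (p : ℝ) (P : Measure Ω) (S : Set (EuclideanSpace ℝ (Fin d)))
    (F : EuclideanSpace ℝ (Fin d) → Ω → ℝ) : ℝ≥0∞ :=
  (∫⁻ ω, cZeroNorm S (fun x => F x ω) ^ p ∂P) ^ (1 / p)

/-- B1: the eigenfunctions are continuously differentiable in `D` (and continuous up to the
boundary, so that the truncated fields lie in `C⁰(closure D)`). -/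
def AssumptionB1 (D : Set (EuclideanSpace ℝ (Fin d)))
    (b : ℕ → EuclideanSpace ℝ (Fin d) → ℝ) : Prop :=
  ∀ m, ContDiffOn ℝ 1 (b m) D ∧ ContinuousOn (b m) (closure D)

/-- B2: the series `∑ λ_m ‖b_m‖_∞²` converges. -/
def AssumptionB2 (D : Set (EuclideanSpace ℝ (Fin d))) (lam : ℕ → ℝ)
    (b : ℕ → EuclideanSpace ℝ (Fin d) → ℝ) : Prop :=
  ∑' m, supTerm D lam b m < ∞

/-- B3: the series `∑ λ_m ‖b_m‖_∞^{2(1-β)} ‖∇b_m‖_∞^{2β}` converges for some `β ∈ (0, 1)`. -/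
def AssumptionB3 (D : Set (EuclideanSpace ℝ (Fin d))) (lam : ℕ → ℝ)
    (b : ℕ → EuclideanSpace ℝ (Fin d) → ℝ) : Prop :=
  ∃ β ∈ Set.Ioo (0 : ℝ) 1, ∑' m, mixedTerm D lam b β m < ∞

end KLField

end

/-!
The remainder of the expansion is estimated in the Hilbert space `L²(P)`, where the centred field is
a continuous curve `x ↦ h x` (`centredField`), the covariance is `⟪h x, h y⟫`, and `√λ_m ξ_m` is the
Bochner integral `η_m = ∫_D b_m h` (`coeffVec`). The eigenvalue equation says
`⟪h x, η_m⟫ = λ_m b_m x`, so that the `η_m` are orthogonal with `‖η_m‖² = λ_m`.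

*Completeness.* Let `w x` be the projection of `h x` to the orthogonal complement of all `η_m`. The
operator `∫_D w ⊗ w` is compact and self-adjoint. An eigenvector `Z` to a nonzero eigenvalue would
make `x ↦ ⟪h x, Z⟫` an eigenfunction of the covariance operator orthogonal to all `b_m`, which is
excluded; so the operator is zero, and `w = 0` on `D` by continuity
(`mem_closure_span_of_exhaustive`). Hence `h x = ∑ b_m x • η_m`, and the second moments of the
remainder `r x` after `M` terms and of its increments are bounded by `∑_{m ≥ M} λ_m b_m(x)²` and
`∑_{m ≥ M} λ_m (b_m x - b_m y)²`; neither Mercer's theorem nor summability is needed.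

*Hölder bound.* In a Lipschitz domain, nearby points are joined by a broken line of comparable
length, so `|b_m x - b_m y|` is at most a constant times `‖∇b_m‖_∞ |x - y|` at short distances.
Interpolation with the sup norm gives `E|r x - r y|² ≤ C R |x - y|^{2β}` with `R = tailMax`
(`IsLipschitzDomain.exists_tsum_enorm_sub_sq_le`).

*Moments of all orders.* On the closed span of the Gaussian family `h x` the `L^q` norm is dominated
by the `L²` norm. Chaining along nets of geometrically growing size then bounds the `q`-th moment of
the supremum of `r` by a constant times `R^{q/2}`, for `q` large
(`exists_forall_lintegral_iSup_rpow_le`). The map `t ↦ φ e^t / (1 + e^t) + a t` is Lipschitz, which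
carries the bound over to the transformed fields, and Jensen's inequality gives all smaller
exponents.

Almost sure continuity of the paths enters in two more places: for Gaussian variables it implies
continuity in mean square, hence of the mean and of `h`, and it gives the joint measurability needed
to identify the pathwise integrals that define `ξ_m` with Bochner integrals in `L²(P)`.
-/

namespace KLField

/-! ### Geometry of Lipschitz domains -/

section Geometry

variable {d : ℕ}

/-- `x` and `y` are joined inside `D` by a broken line of three segments whose length is at most
`C` times the distance of `x` and `y`. -/
def JoinedByBrokenLine (D : Set (EuclideanSpace ℝ (Fin d))) (C : ℝ≥0)
    (x y : EuclideanSpace ℝ (Fin d)) : Prop :=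
  ∃ z w, segment ℝ x z ⊆ D ∧ segment ℝ z w ⊆ D ∧ segment ℝ w y ⊆ D ∧
    dist x z + dist z w + dist w y ≤ C * dist x y

lemma JoinedByBrokenLine.mono {D : Set (EuclideanSpace ℝ (Fin d))} {C C' : ℝ≥0}
    {x y : EuclideanSpace ℝ (Fin d)} (h : JoinedByBrokenLine D C x y) (hC : C ≤ C') :
    JoinedByBrokenLine D C' x y := by
  obtain ⟨z, w, h₁, h₂, h₃, h₄⟩ := h
  exact ⟨z, w, h₁, h₂, h₃, h₄.trans (by gcongr)⟩

/-- Near a boundary point, the broken line moves up from both end points in the direction `ν` by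
`L * dist x y` and connects the two lifted points by a segment: since the boundary function is
`L`-Lipschitz, that segment lies above its graph. -/
lemma IsLipschitzDomain.joinedByBrokenLine_of_mem_frontier
    {D : Set (EuclideanSpace ℝ (Fin d))} (hD : IsLipschitzDomain D)
    {x₀ : EuclideanSpace ℝ (Fin d)} (hx₀ : x₀ ∈ frontier D) :
    ∃ ρ > 0, ∃ C : ℝ≥0, ∀ x ∈ D ∩ Metric.ball x₀ ρ, ∀ y ∈ D ∩ Metric.ball x₀ ρ,
      JoinedByBrokenLine D C x y := by
  obtain ⟨ν, γ, L, r, hν, hγ, hr, hball⟩ := hD.lipschitz_boundary x₀ hx₀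
  have hL : (0 : ℝ) ≤ L := L.2
  have hνν : inner ℝ ν ν = (1 : ℝ) := by rw [real_inner_self_eq_norm_sq, hν]; norm_num
  set ρ : ℝ := r / (1 + 2 * L) with hρ
  have hρ0 : 0 < ρ := by positivity
  have hρr : ρ + 2 * L * ρ = r := by rw [hρ]; field_simp
  refine ⟨ρ, hρ0, 1 + 2 * L, ?_⟩
  rintro x ⟨hxD, hx⟩ y ⟨hyD, hy⟩
  set π : EuclideanSpace ℝ (Fin d) → EuclideanSpace ℝ (Fin d) :=
    fun z => z - inner ℝ ν z • ν with hπ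
  have hπlip : ∀ z w, dist (π z) (π w) ≤ dist z w := by
    intro z w
    rw [dist_eq_norm, dist_eq_norm]
    have h1 : π z - π w = (z - w) - inner ℝ ν (z - w) • ν := by
      simp only [hπ, inner_sub_right, sub_smul]; abel
    have h2 : ‖π z - π w‖ ^ 2 ≤ ‖z - w‖ ^ 2 := by
      rw [h1, @norm_sub_sq_real, inner_smul_right, norm_smul, hν, real_inner_comm]
      simp only [Real.norm_eq_abs, mul_one, sq_abs]
      nlinarith [sq_nonneg (inner ℝ ν (z - w))]
    exact (sq_le_sq₀ (norm_nonneg _) (norm_nonneg _)).1 h2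
  have hπν : ∀ z (s : ℝ), π (z + s • ν) = π z := by
    intro z s
    simp only [hπ, inner_add_right, inner_smul_right, hνν, add_smul, mul_one]; abel
  have hνadd : ∀ z (s : ℝ), inner ℝ ν (z + s • ν) = inner ℝ ν z + s := by
    intro z s
    rw [inner_add_right, inner_smul_right, hνν, mul_one]
  have hxr : x ∈ Metric.ball x₀ r := Metric.ball_subset_ball (by nlinarith) hx
  have hyr : y ∈ Metric.ball x₀ r := Metric.ball_subset_ball (by nlinarith) hy
  have hxγ := (hball x hxr).1 hxD
  have hyγ := (hball y hyr).1 hyD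
  have hγd : ∀ z w, γ (π z) ≤ γ (π w) + L * dist z w := by
    intro z w
    have := hγ.dist_le_mul (π z) (π w)
    rw [Real.dist_eq] at this
    nlinarith [le_abs_self (γ (π z) - γ (π w)), hπlip z w]
  have hxy : dist x y < 2 * ρ := by
    have := dist_triangle_right x y x₀
    have := Metric.mem_ball.1 hx
    have := Metric.mem_ball.1 hy
    linarith
  -- a point of the segment, lifted by `s`, stays in the ball where `D` is an epigraph
  have key : ∀ t ∈ Set.Icc (0 : ℝ) 1, ∀ s ∈ Set.Icc 0 (L * dist x y),
      γ (π (AffineMap.lineMap x y t)) < inner ℝ ν (AffineMap.lineMap x y t) + s →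
      AffineMap.lineMap x y t + s • ν ∈ D := by
    intro t ht s hs h
    have hm : AffineMap.lineMap x y t ∈ Metric.ball x₀ ρ :=
      (convex_ball x₀ ρ).lineMap_mem hx hy ht
    have hm' : AffineMap.lineMap x y t + s • ν ∈ Metric.ball x₀ r := by
      rw [Metric.mem_ball] at hm ⊢
      calc dist (AffineMap.lineMap x y t + s • ν) x₀
          ≤ dist (AffineMap.lineMap x y t + s • ν) (AffineMap.lineMap x y t)
            + dist (AffineMap.lineMap x y t) x₀ := dist_triangle _ _ _
        _ = s + dist (AffineMap.lineMap x y t) x₀ := by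
            rw [dist_self_add_left, norm_smul, hν, Real.norm_of_nonneg hs.1, mul_one]
        _ < r := by nlinarith [hs.2, mul_le_mul_of_nonneg_left hxy.le hL]
    rw [hball _ hm']
    change γ (π _) < _
    rw [hπν, hνadd]
    exact h
  set S : ℝ := L * dist x y with hS
  have hS0 : 0 ≤ S := by positivity
  refine ⟨x + S • ν, y + S • ν, ?_, ?_, ?_, ?_⟩
  · rw [segment_eq_image']
    rintro _ ⟨θ, hθ, rfl⟩
    have := key 0 (by simp) (θ * S) ⟨mul_nonneg hθ.1 hS0, mul_le_of_le_one_left hS0 hθ.2⟩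
      (by simp only [AffineMap.lineMap_apply_zero]; nlinarith [mul_nonneg hθ.1 hS0, hxγ])
    simpa [smul_smul] using this
  · rw [segment_eq_image_lineMap]
    rintro _ ⟨θ, hθ, rfl⟩
    have h1 : AffineMap.lineMap (x + S • ν) (y + S • ν) θ
        = AffineMap.lineMap x y θ + S • ν := by
      simp only [AffineMap.lineMap_apply_module']; module
    rw [h1]
    refine key θ hθ S ⟨hS0, le_rfl⟩ ?_
    have h2 : inner ℝ ν (AffineMap.lineMap x y θ : EuclideanSpace ℝ (Fin d))
        = (1 - θ) * inner ℝ ν x + θ * inner ℝ ν y := by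
      simp only [AffineMap.lineMap_apply_module, inner_add_right, inner_smul_right]
    have h3 := hγd (AffineMap.lineMap x y θ) x
    have h4 := hγd (AffineMap.lineMap x y θ) y
    rw [dist_lineMap_left, Real.norm_of_nonneg hθ.1] at h3
    rw [dist_lineMap_right, Real.norm_of_nonneg (by linarith [hθ.2])] at h4
    change γ (π x) < _ at hxγ
    change γ (π y) < _ at hyγ
    rw [h2]
    have hθ1 : 0 ≤ 1 - θ := by linarith [hθ.2]
    have e3 := mul_le_mul_of_nonneg_left h3 hθ1
    have e4 := mul_le_mul_of_nonneg_left h4 hθ.1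
    have e5 : (1 - θ) * γ (π x) + θ * γ (π y) < (1 - θ) * inner ℝ ν x + θ * inner ℝ ν y := by
      rcases hθ.1.eq_or_lt with h | h
      · subst h; simpa using hxγ
      · nlinarith [mul_le_mul_of_nonneg_left hxγ.le hθ1, mul_lt_mul_of_pos_left hyγ h]
    have e6 : θ * (1 - θ) ≤ 1 / 2 := by nlinarith [sq_nonneg (θ - 1 / 2)]
    have e7 := mul_le_mul_of_nonneg_right e6 hS0
    have e8 : (1 - θ) * (L * (θ * dist x y)) = θ * (1 - θ) * S := by rw [hS]; ring
    have e9 : θ * (L * ((1 - θ) * dist x y)) = θ * (1 - θ) * S := by rw [hS]; ring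
    nlinarith
  · rw [segment_eq_image']
    rintro _ ⟨θ, hθ, rfl⟩
    have hθ1 : 0 ≤ 1 - θ := by linarith [hθ.2]
    have := key 1 (by simp) ((1 - θ) * S) ⟨mul_nonneg hθ1 hS0,
      mul_le_of_le_one_left hS0 (by linarith [hθ.1])⟩
      (by simp only [AffineMap.lineMap_apply_one]; nlinarith [mul_nonneg hθ1 hS0, hyγ])
    simp only [AffineMap.lineMap_apply_one] at this
    convert this using 1
    module
  · have h1 : dist x (x + S • ν) = S := by
      rw [dist_self_add_right, norm_smul, hν, Real.norm_of_nonneg hS0, mul_one]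
    have h2 : dist (y + S • ν) y = S := by
      rw [dist_self_add_left, norm_smul, hν, Real.norm_of_nonneg hS0, mul_one]
    rw [h1, h2, dist_add_right]
    push_cast
    rw [hS]; nlinarith

/-- A Lipschitz domain is uniformly locally quasiconvex. -/
lemma IsLipschitzDomain.exists_joinedByBrokenLine
    {D : Set (EuclideanSpace ℝ (Fin d))} (hD : IsLipschitzDomain D) :
    ∃ δ > 0, ∃ C : ℝ≥0, ∀ x ∈ D, ∀ y ∈ D, dist x y < δ → JoinedByBrokenLine D C x y := by
  have hK : IsCompact (closure D) := hD.isBounded.isCompact_closure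
  suffices H : ∃ δ > 0, ∃ C : ℝ≥0, ∀ x ∈ D ∩ closure D, ∀ y ∈ D, dist x y < δ →
      JoinedByBrokenLine D C x y by
    obtain ⟨δ, hδ, C, h⟩ := H
    exact ⟨δ, hδ, C, fun x hx => h x ⟨hx, subset_closure hx⟩⟩
  refine hK.induction_on (p := fun S => ∃ δ > 0, ∃ C : ℝ≥0, ∀ x ∈ D ∩ S, ∀ y ∈ D, dist x y < δ →
      JoinedByBrokenLine D C x y) ⟨1, one_pos, 0, by simp⟩ ?_ ?_ ?_
  · rintro s t hst ⟨δ, hδ, C, h⟩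
    exact ⟨δ, hδ, C, fun x hx => h x ⟨hx.1, hst hx.2⟩⟩
  · rintro s t ⟨δ, hδ, C, h⟩ ⟨δ', hδ', C', h'⟩
    refine ⟨min δ δ', lt_min hδ hδ', max C C', ?_⟩
    rintro x ⟨hx, hs | ht⟩ y hy hxy
    · exact (h x ⟨hx, hs⟩ y hy (hxy.trans_le (min_le_left _ _))).mono (le_max_left _ _)
    · exact (h' x ⟨hx, ht⟩ y hy (hxy.trans_le (min_le_right _ _))).mono (le_max_right _ _)
  · intro x₀ hx₀
    have H : ∃ ρ > 0, ∃ C : ℝ≥0, ∀ x ∈ D ∩ Metric.ball x₀ ρ, ∀ y ∈ D ∩ Metric.ball x₀ ρ,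
        JoinedByBrokenLine D C x y := by
      by_cases hx₀D : x₀ ∈ D
      · obtain ⟨ρ, hρ, hb⟩ := Metric.isOpen_iff.1 hD.isOpen x₀ hx₀D
        refine ⟨ρ, hρ, 1, fun x hx y hy => ⟨x, x, ?_, ?_, ?_, by simp⟩⟩
        · simpa using hx.1
        · simpa using hx.1
        · exact ((convex_ball x₀ ρ).segment_subset hx.2 hy.2).trans hb
      · exact hD.joinedByBrokenLine_of_mem_frontier
          (by rw [hD.isOpen.frontier_eq]; exact ⟨hx₀, hx₀D⟩)
    obtain ⟨ρ, hρ, C, h⟩ := H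
    refine ⟨Metric.ball x₀ (ρ / 2),
      mem_nhdsWithin_of_mem_nhds (Metric.ball_mem_nhds _ (by positivity)),
      ρ / 2, by positivity, C, ?_⟩
    rintro x ⟨hx, hxb⟩ y hy hxy
    rw [Metric.mem_ball] at hxb
    refine h x ⟨hx, Metric.mem_ball.2 (by linarith)⟩ y ⟨hy, Metric.mem_ball.2 ?_⟩
    linarith [dist_triangle_left y x₀ x]

/-- On an open set, the essential supremum of a continuous function bounds it at every point. -/
lemma enorm_le_eLpNorm_top_of_continuousOn {F : Type*} [NormedAddCommGroup F]
    {D : Set (EuclideanSpace ℝ (Fin d))} (hD : IsOpen D)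
    {f : EuclideanSpace ℝ (Fin d) → F} (hf : ContinuousOn f D)
    {x : EuclideanSpace ℝ (Fin d)} (hx : x ∈ D) :
    ‖f x‖ₑ ≤ eLpNorm f ⊤ (volume.restrict D) := by
  by_contra! h
  have hopen : IsOpen (D ∩ {y | eLpNorm f ⊤ (volume.restrict D) < ‖f y‖ₑ}) :=
    hf.enorm.isOpen_inter_preimage hD isOpen_Ioi
  have h0 : volume (D ∩ {y | eLpNorm f ⊤ (volume.restrict D) < ‖f y‖ₑ}) = 0 := by
    have := ae_le_eLpNormEssSup (f := f) (μ := volume.restrict D)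
    rw [← eLpNorm_exponent_top, ae_restrict_iff' hD.measurableSet, ae_iff] at this
    refine measure_mono_null ?_ this
    rintro y ⟨hy, hy'⟩
    simp only [Set.mem_ofPred_eq] at hy' ⊢
    push Not
    exact ⟨hy, hy'⟩
  exact absurd (hopen.eq_empty_of_measure_zero h0) (Set.Nonempty.ne_empty ⟨x, hx, h⟩)

lemma enorm_sub_le_gradSupNorm_mul_edist_of_segment_subset
    {D : Set (EuclideanSpace ℝ (Fin d))} (hD : IsOpen D)
    {f : EuclideanSpace ℝ (Fin d) → ℝ} (hf : ContDiffOn ℝ 1 f D)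
    {x y : EuclideanSpace ℝ (Fin d)} (hxy : segment ℝ x y ⊆ D) :
    ‖f x - f y‖ₑ ≤ gradSupNorm D f * edist x y := by
  rcases eq_or_ne x y with rfl | hne
  · simp
  have hcont : ContinuousOn (gradient f) D := by
    have := hf.continuousOn_fderiv_of_isOpen hD le_rfl
    exact (LinearIsometryEquiv.continuous _).comp_continuousOn this
  rcases eq_or_ne (gradSupNorm D f) ⊤ with htop | htop
  · rw [htop, ENNReal.top_mul (by simpa using hne)]; exact le_top
  have hbound : ∀ z ∈ segment ℝ x y, ‖fderiv ℝ f z‖ ≤ (gradSupNorm D f).toReal := by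
    intro z hz
    have h1 := enorm_le_eLpNorm_top_of_continuousOn hD hcont (hxy hz)
    have h2 : ‖gradient f z‖ = ‖fderiv ℝ f z‖ := by simp [gradient]
    rw [← h2, ← toReal_enorm]
    exact ENNReal.toReal_mono htop h1
  have h := (convex_segment x y).norm_image_sub_le_of_norm_hasFDerivWithin_le
    (f := f) (f' := fderiv ℝ f) (C := (gradSupNorm D f).toReal)
    (fun z hz => ((hf.differentiableOn one_ne_zero).differentiableAt
      (hD.mem_nhds (hxy hz))).hasFDerivAt.hasFDerivWithinAt) hbound
    (right_mem_segment ℝ x y) (left_mem_segment ℝ x y)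
  rw [← ofReal_norm, edist_dist, dist_eq_norm, ← ENNReal.ofReal_toReal htop,
    ← ENNReal.ofReal_mul ENNReal.toReal_nonneg]
  exact ENNReal.ofReal_le_ofReal h

lemma JoinedByBrokenLine.enorm_sub_le
    {D : Set (EuclideanSpace ℝ (Fin d))} (hD : IsOpen D) {C : ℝ≥0}
    {f : EuclideanSpace ℝ (Fin d) → ℝ} (hf : ContDiffOn ℝ 1 f D)
    {x y : EuclideanSpace ℝ (Fin d)} (h : JoinedByBrokenLine D C x y) :
    ‖f x - f y‖ₑ ≤ gradSupNorm D f * (C * edist x y) := by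
  obtain ⟨z, w, h₁, h₂, h₃, h₄⟩ := h
  have e : f x - f y = (f x - f z) + (f z - f w) + (f w - f y) := by ring
  have hlen : edist x z + edist z w + edist w y ≤ C * edist x y := by
    rw [edist_dist, edist_dist, edist_dist, edist_dist, ← ENNReal.ofReal_coe_nnreal,
      ← ENNReal.ofReal_mul (NNReal.coe_nonneg C), ← ENNReal.ofReal_add dist_nonneg dist_nonneg,
      ← ENNReal.ofReal_add (by positivity) dist_nonneg]
    exact ENNReal.ofReal_le_ofReal h₄
  calc ‖f x - f y‖ₑ ≤ ‖f x - f z‖ₑ + ‖f z - f w‖ₑ + ‖f w - f y‖ₑ := by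
        rw [e]
        exact (enorm_add_le _ _).trans (by gcongr; exact enorm_add_le _ _)
    _ ≤ gradSupNorm D f * edist x z + gradSupNorm D f * edist z w
        + gradSupNorm D f * edist w y := by
        gcongr
        · exact enorm_sub_le_gradSupNorm_mul_edist_of_segment_subset hD hf h₁
        · exact enorm_sub_le_gradSupNorm_mul_edist_of_segment_subset hD hf h₂
        · exact enorm_sub_le_gradSupNorm_mul_edist_of_segment_subset hD hf h₃
    _ = gradSupNorm D f * (edist x z + edist z w + edist w y) := by ring
    _ ≤ _ := by gcongr

/-- Summed over the tail, the squared increments of the eigenfunctions are `β`-Hölder with constant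
`tailMax`: at short distances by interpolating between the sup norm and the gradient along a broken
line, at large distances by the sup norm alone. -/
lemma IsLipschitzDomain.exists_tsum_enorm_sub_sq_le
    {D : Set (EuclideanSpace ℝ (Fin d))} (hD : IsLipschitzDomain D) {β : ℝ}
    (hβ : β ∈ Set.Ioo (0 : ℝ) 1) :
    ∃ C : ℝ≥0, ∀ (lam : ℕ → ℝ) (b : ℕ → EuclideanSpace ℝ (Fin d) → ℝ), AssumptionB1 D b →
      ∀ M, ∀ x ∈ D, ∀ y ∈ D,
        ∑' m, ENNReal.ofReal (lam (m + M)) * ‖b (m + M) x - b (m + M) y‖ₑ ^ 2 ≤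
          C * tailMax D lam b β M * edist x y ^ (2 * β) := by
  obtain ⟨δ, hδ, C, hC⟩ := hD.exists_joinedByBrokenLine
  have hβ1 : 0 < 2 * (1 - β) := by linarith [hβ.2]
  have hβ0 : 0 < 2 * β := by linarith [hβ.1]
  set C₁ : ℝ≥0 := 2 ^ (2 * (1 - β)) * C ^ (2 * β) with hC₁
  set C₂ : ℝ≥0 := 4 * (Real.toNNReal δ)⁻¹ ^ (2 * β) with hC₂
  have hδ' : Real.toNNReal δ ≠ 0 := by simpa using hδ
  refine ⟨max C₁ C₂, fun lam b hb M x hx y hy => ?_⟩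
  have hsup : ∀ m, ‖b m x - b m y‖ₑ ≤ 2 * supNorm D (b m) := by
    intro m
    have hc := (hb m).1.continuousOn
    calc ‖b m x - b m y‖ₑ ≤ ‖b m x‖ₑ + ‖b m y‖ₑ := enorm_sub_le
      _ ≤ supNorm D (b m) + supNorm D (b m) := add_le_add
          (enorm_le_eLpNorm_top_of_continuousOn hD.isOpen hc hx)
          (enorm_le_eLpNorm_top_of_continuousOn hD.isOpen hc hy)
      _ = _ := by ring
  rcases lt_or_ge (dist x y) δ with hlt | hge
  · have hterm : ∀ m, ENNReal.ofReal (lam m) * ‖b m x - b m y‖ₑ ^ 2 ≤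
        C₁ * mixedTerm D lam b β m * edist x y ^ (2 * β) := by
      intro m
      have hgrad := (hC x hx y hy hlt).enorm_sub_le hD.isOpen (hb m).1
      have hsplit : ‖b m x - b m y‖ₑ ^ 2
          = ‖b m x - b m y‖ₑ ^ (2 * (1 - β)) * ‖b m x - b m y‖ₑ ^ (2 * β) := by
        rw [← ENNReal.rpow_add_of_nonneg _ _ hβ1.le hβ0.le, ← ENNReal.rpow_two]
        congr 1; ring
      calc ENNReal.ofReal (lam m) * ‖b m x - b m y‖ₑ ^ 2
          ≤ ENNReal.ofReal (lam m) * ((2 * supNorm D (b m)) ^ (2 * (1 - β)) *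
              (gradSupNorm D (b m) * (C * edist x y)) ^ (2 * β)) := by
            rw [hsplit]
            gcongr
            exact hsup m
        _ = C₁ * mixedTerm D lam b β m * edist x y ^ (2 * β) := by
            rw [mixedTerm, hC₁, ENNReal.mul_rpow_of_nonneg _ _ hβ1.le,
              ENNReal.mul_rpow_of_nonneg _ _ hβ0.le, ENNReal.mul_rpow_of_nonneg _ _ hβ0.le,
              ENNReal.coe_mul, ENNReal.coe_rpow_of_nonneg _ hβ1.le,
              ENNReal.coe_rpow_of_nonneg _ hβ0.le]
            push_cast
            ring
    calc _ ≤ ∑' m, C₁ * mixedTerm D lam b β (m + M) * edist x y ^ (2 * β) :=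
          ENNReal.tsum_le_tsum fun m => hterm _
      _ = C₁ * (∑' m, mixedTerm D lam b β (m + M)) * edist x y ^ (2 * β) := by
          rw [ENNReal.tsum_mul_right, ENNReal.tsum_mul_left]
      _ ≤ _ := by
          gcongr
          · exact le_max_left _ _
          · exact le_max_right _ _
  · have hone : 1 ≤ ((Real.toNNReal δ)⁻¹ : ℝ≥0∞) ^ (2 * β) * edist x y ^ (2 * β) := by
      rw [← ENNReal.mul_rpow_of_nonneg _ _ hβ0.le]
      refine ENNReal.one_le_rpow ?_ hβ0
      rw [edist_dist, mul_comm, ← div_eq_mul_inv,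
        ENNReal.le_div_iff_mul_le (by simp [hδ]) (by simp), one_mul]
      exact ENNReal.ofReal_le_ofReal hge
    have hterm : ∀ m, ENNReal.ofReal (lam m) * ‖b m x - b m y‖ₑ ^ 2 ≤
        C₂ * supTerm D lam b m * edist x y ^ (2 * β) := by
      intro m
      calc ENNReal.ofReal (lam m) * ‖b m x - b m y‖ₑ ^ 2
          ≤ ENNReal.ofReal (lam m) * (2 * supNorm D (b m)) ^ 2 * 1 := by
            rw [mul_one]; gcongr; exact hsup m
        _ ≤ ENNReal.ofReal (lam m) * (2 * supNorm D (b m)) ^ 2 *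
            (((Real.toNNReal δ)⁻¹ : ℝ≥0∞) ^ (2 * β) * edist x y ^ (2 * β)) := by gcongr
        _ = _ := by
            rw [supTerm, hC₂, ENNReal.coe_mul, ENNReal.coe_rpow_of_nonneg _ hβ0.le,
              ENNReal.coe_inv hδ']
            push_cast
            ring
    calc _ ≤ ∑' m, C₂ * supTerm D lam b (m + M) * edist x y ^ (2 * β) :=
          ENNReal.tsum_le_tsum fun m => hterm _
      _ = C₂ * (∑' m, supTerm D lam b (m + M)) * edist x y ^ (2 * β) := by
          rw [ENNReal.tsum_mul_right, ENNReal.tsum_mul_left]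
      _ ≤ _ := by
          gcongr
          · exact le_max_right _ _
          · exact le_max_left _ _

end Geometry

/-! ### Nets and chaining -/

section Chaining

/-- Pathwise chaining: along a sequence of net points converging to `x`, a continuous function is
controlled by its increments along the chain. -/
lemma enorm_le_of_chain {E : Type*} [NormedAddCommGroup E] {D : Set E} {v : E → ℝ}
    (hv : ContinuousOn v (closure D)) {x : E} (hx : x ∈ closure D) (s : ℕ → E) (hsD : ∀ n, s n ∈ D)
    (hs : Filter.Tendsto s Filter.atTop (nhds x)) (Z : ℝ≥0∞) (θ : ℝ≥0∞)
    (h0 : ‖v (s 0)‖ₑ ≤ Z) (hstep : ∀ n, ‖v (s (n + 1)) - v (s n)‖ₑ ≤ θ ^ n * Z) :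
    ‖v x‖ₑ ≤ (1 + (1 - θ)⁻¹) * Z := by
  have hN : ∀ n, ‖v (s n)‖ₑ ≤ Z + (∑ k ∈ Finset.range n, θ ^ k) * Z := by
    intro n
    induction n with
    | zero => simpa using h0
    | succ n ih =>
      calc ‖v (s (n + 1))‖ₑ = ‖v (s n) + (v (s (n + 1)) - v (s n))‖ₑ := by congr 1; ring
        _ ≤ ‖v (s n)‖ₑ + ‖v (s (n + 1)) - v (s n)‖ₑ := enorm_add_le _ _
        _ ≤ Z + (∑ k ∈ Finset.range n, θ ^ k) * Z + θ ^ n * Z := add_le_add ih (hstep n)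
        _ = _ := by rw [Finset.sum_range_succ]; ring
  have hlim : Filter.Tendsto (fun n => ‖v (s n)‖ₑ) Filter.atTop (nhds ‖v x‖ₑ) := by
    refine (continuous_enorm.tendsto _).comp ((hv x hx).tendsto.comp ?_)
    exact tendsto_nhdsWithin_iff.2 ⟨hs, Filter.Eventually.of_forall fun n => subset_closure (hsD n)⟩
  refine le_of_tendsto' hlim fun n => (hN n).trans ?_
  rw [add_mul, one_mul, ← ENNReal.tsum_geometric]
  gcongr
  exact ENNReal.sum_le_tsum _

variable {E : Type*} [NormedAddCommGroup E] [NormedSpace ℝ E] [FiniteDimensional ℝ E]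

/-- Covering numbers of a bounded set at the scales `2⁻ⁿ` grow at most geometrically: each ball is
covered by a fixed number of balls of half its radius. -/
lemma exists_finset_cover_card_le {D : Set E} (hD : Bornology.IsBounded D) :
    ∃ N₀ N : ℕ, ∀ n : ℕ, ∃ T : Finset E, T.card ≤ N₀ * N ^ n ∧
      ∀ x ∈ D, ∃ t ∈ T, dist x t ≤ (1 / 2 : ℝ) ^ n := by
  classical
  obtain ⟨F, hF⟩ : ∃ F : Finset E, ∀ x ∈ Metric.closedBall (0 : E) 1, ∃ t ∈ F,
      dist x t ≤ 1 / 2 := by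
    obtain ⟨F, -, hfin, hF⟩ := Metric.finite_approx_of_totallyBounded
      (isCompact_closedBall (0 : E) 1).totallyBounded (1 / 2) (by norm_num)
    refine ⟨hfin.toFinset, fun x hx => ?_⟩
    obtain ⟨t, ht, hxt⟩ := Set.mem_iUnion₂.1 (hF hx)
    exact ⟨t, by simpa using ht, (Metric.mem_ball.1 hxt).le⟩
  obtain ⟨T₀, hT₀⟩ : ∃ T : Finset E, ∀ x ∈ D, ∃ t ∈ T, dist x t ≤ 1 := by
    obtain ⟨T, -, hfin, hT⟩ := Metric.finite_approx_of_totallyBounded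
      (hD.isCompact_closure.totallyBounded.subset subset_closure) 1 one_pos
    refine ⟨hfin.toFinset, fun x hx => ?_⟩
    obtain ⟨t, ht, hxt⟩ := Set.mem_iUnion₂.1 (hT hx)
    exact ⟨t, by simpa using ht, (Metric.mem_ball.1 hxt).le⟩
  refine ⟨T₀.card, F.card, fun n => ?_⟩
  induction n with
  | zero => exact ⟨T₀, by simp, by simpa using hT₀⟩
  | succ n ih =>
    obtain ⟨T, hcard, hT⟩ := ih
    set r : ℝ := (1 / 2) ^ n with hr
    have hr0 : 0 < r := by positivity
    refine ⟨Finset.image₂ (fun t s => t + r • s) T F, ?_, fun x hx => ?_⟩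
    · calc _ ≤ T.card * F.card := Finset.card_image₂_le _ _ _
        _ ≤ T₀.card * F.card ^ n * F.card := by gcongr
        _ = _ := by ring
    · obtain ⟨t, ht, hxt⟩ := hT x hx
      obtain ⟨s, hs, hxs⟩ := hF (r⁻¹ • (x - t)) (by
        rw [mem_closedBall_zero_iff, norm_smul, norm_inv, Real.norm_of_nonneg hr0.le,
          ← dist_eq_norm, inv_mul_le_iff₀ hr0, mul_one]
        exact hxt)
      refine ⟨t + r • s, Finset.mem_image₂.2 ⟨t, ht, s, hs, rfl⟩, ?_⟩
      have : x - (t + r • s) = r • (r⁻¹ • (x - t) - s) := by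
        rw [smul_sub, smul_inv_smul₀ hr0.ne']; abel
      rw [dist_eq_norm, this, norm_smul, Real.norm_of_nonneg hr0.le, pow_succ, ← dist_eq_norm]
      gcongr

/-- The nets of `exists_finset_cover_card_le` can be chosen inside the set, and then serve its
closure as well. -/
lemma exists_finset_net_card_le {D : Set E} (hD : Bornology.IsBounded D) :
    ∃ N₀ N : ℕ, ∀ n : ℕ, ∃ S : Finset E, ↑S ⊆ D ∧ S.card ≤ N₀ * N ^ n ∧
      ∀ x ∈ closure D, ∃ s ∈ S, dist x s ≤ 3 * (1 / 2 : ℝ) ^ n := by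
  classical
  obtain ⟨N₀, N, h⟩ := exists_finset_cover_card_le hD
  refine ⟨N₀, N, fun n => ?_⟩
  obtain ⟨T, hcard, hT⟩ := h n
  set r : ℝ := (1 / 2) ^ n with hr
  have hr0 : 0 < r := by positivity
  have hch : ∀ t : E, ∃ s : E, (∃ x ∈ D, dist x t ≤ r) → s ∈ D ∧ dist s t ≤ r := by
    intro t
    by_cases ht : ∃ x ∈ D, dist x t ≤ r
    · obtain ⟨x, hx, hxt⟩ := ht
      exact ⟨x, fun _ => ⟨hx, hxt⟩⟩
    · exact ⟨t, fun h => absurd h ht⟩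
  choose f hf using hch
  refine ⟨(T.filter fun t => ∃ x ∈ D, dist x t ≤ r).image f, ?_, ?_, ?_⟩
  · intro s hs
    obtain ⟨t, ht, rfl⟩ := Finset.mem_image.1 (Finset.mem_coe.1 hs)
    exact (hf t (Finset.mem_filter.1 ht).2).1
  · exact Finset.card_image_le.trans ((Finset.card_filter_le _ _).trans hcard)
  · intro x hx
    obtain ⟨y, hy, hxy⟩ := Metric.mem_closure_iff.1 hx r hr0
    obtain ⟨t, ht, hyt⟩ := hT y hy
    refine ⟨f t, Finset.mem_image_of_mem _ (Finset.mem_filter.2 ⟨ht, y, hy, hyt⟩), ?_⟩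
    have h1 := (hf t ⟨y, hy, hyt⟩).2
    rw [dist_comm] at h1
    linarith [dist_triangle x y (f t), dist_triangle y t (f t)]

/-- Kolmogorov's chaining bound: for all sufficiently large exponents `q`, moment bounds of order
`q` for the values of a continuous process and for its increments (`β`-Hölder) bound the `q`-th
moment of its supremum. The point is that the bound is linear in the constant `A`. -/
theorem exists_forall_lintegral_iSup_rpow_le {Ω : Type*} [MeasurableSpace Ω] (P : Measure Ω)
    {D : Set E} (hD : Bornology.IsBounded D) {β : ℝ} (hβ : 0 < β) :
    ∃ q₀ : ℝ, ∀ q : ℝ, q₀ ≤ q → 0 < q → ∃ C : ℝ≥0, ∀ (u : E → Ω → ℝ) (A : ℝ≥0∞),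
      (∀ x ∈ D, AEMeasurable (u x) P) →
      (∀ᵐ ω ∂P, ContinuousOn (fun x => u x ω) (closure D)) →
      (∀ x ∈ D, ∫⁻ ω, ‖u x ω‖ₑ ^ q ∂P ≤ A) →
      (∀ x ∈ D, ∀ y ∈ D, ∫⁻ ω, ‖u x ω - u y ω‖ₑ ^ q ∂P ≤ A * edist x y ^ (β * q)) →
      ∫⁻ ω, (⨆ x ∈ closure D, ‖u x ω‖ₑ) ^ q ∂P ≤ C * A := by
  classical
  obtain ⟨N₀, N, hnet⟩ := exists_finset_net_card_le hD
  choose S hSD hcard hS using hnet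
  -- with this choice, `N ^ 2 * 2 ^ (-β q / 2) ≤ 1 / 2`
  refine ⟨(4 * N + 2) / β, fun q hq hq0 => ?_⟩
  have hqβ : 4 * N + 2 ≤ q * β := by rwa [div_le_iff₀ hβ] at hq
  set θ : ℝ≥0∞ := (2 : ℝ≥0∞) ^ (-(β / 2)) with hθ
  have hθ1 : θ < 1 := by
    rw [hθ, ENNReal.rpow_neg, ENNReal.inv_lt_one]
    exact ENNReal.one_lt_rpow (by norm_num) (by positivity)
  have hθ0 : θ ≠ 0 := by simp [hθ]
  have hθt : θ ≠ ⊤ := (hθ1.trans ENNReal.one_lt_top).ne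
  set κ : ℝ≥0∞ := 1 + (1 - θ)⁻¹ with hκ
  have hκt : κ ≠ ⊤ := by
    rw [hκ]
    exact ENNReal.add_ne_top.2 ⟨by simp, ENNReal.inv_ne_top.2 (tsub_pos_of_lt hθ1).ne'⟩
  set B : ℝ≥0∞ := N₀ + 2 * ((N₀ : ℝ≥0∞) ^ 2 * N * 6 ^ (β * q)) with hB
  have hBt : B ≠ ⊤ := by
    rw [hB]
    refine ENNReal.add_ne_top.2 ⟨by simp, ENNReal.mul_ne_top (by simp) (ENNReal.mul_ne_top ?_ ?_)⟩
    · exact ENNReal.mul_ne_top (by simp) (by simp)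
    · exact ENNReal.rpow_ne_top_of_nonneg (by positivity) (by simp)
  refine ⟨(κ ^ q * B).toNNReal, fun u A hmeas hcont hval hincr => ?_⟩
  rw [ENNReal.coe_toNNReal (ENNReal.mul_ne_top (ENNReal.rpow_ne_top_of_nonneg hq0.le hκt) hBt)]
  -- the pairs of neighbouring net points at two consecutive scales
  set pairs : ℕ → Finset (E × E) := fun n =>
    (S n ×ˢ S (n + 1)).filter fun p => dist p.1 p.2 ≤ 6 * (1 / 2 : ℝ) ^ n with hpairs
  have hpD : ∀ n, ∀ p ∈ pairs n, p.1 ∈ D ∧ p.2 ∈ D := by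
    intro n p hp
    have := Finset.mem_product.1 (Finset.mem_filter.1 hp).1
    exact ⟨hSD n this.1, hSD (n + 1) this.2⟩
  set Z : Ω → ℝ≥0∞ := fun ω => ∑ s ∈ S 0, ‖u s ω‖ₑ ^ q +
    ∑' n, (θ⁻¹ ^ n) ^ q * ∑ p ∈ pairs n, ‖u p.2 ω - u p.1 ω‖ₑ ^ q with hZ
  have hpath : ∀ᵐ ω ∂P, (⨆ x ∈ closure D, ‖u x ω‖ₑ) ^ q ≤ κ ^ q * Z ω := by
    filter_upwards [hcont] with ω hω
    have hroot : κ ^ q * Z ω = (κ * Z ω ^ q⁻¹) ^ q := by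
      rw [ENNReal.mul_rpow_of_nonneg _ _ hq0.le, ← ENNReal.rpow_mul,
        inv_mul_cancel₀ hq0.ne', ENNReal.rpow_one]
    rw [hroot]
    gcongr
    refine iSup₂_le fun x hx => ?_
    choose s hsS hsx using fun n => hS n x hx
    refine enorm_le_of_chain hω hx s (fun n => hSD n (hsS n)) ?_ _ θ ?_ ?_
    · refine tendsto_iff_dist_tendsto_zero.2 (squeeze_zero (fun _ => dist_nonneg)
        (fun n => (dist_comm _ _).trans_le (hsx n)) ?_)
      simpa only [mul_zero] using (tendsto_pow_atTop_nhds_zero_of_lt_one (r := (1 / 2 : ℝ))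
        (by norm_num) (by norm_num)).const_mul 3
    · rw [ENNReal.le_rpow_inv_iff hq0]
      refine le_trans ?_ le_self_add
      exact Finset.single_le_sum (f := fun t => ‖u t ω‖ₑ ^ q) (fun _ _ => zero_le) (hsS 0)
    · intro n
      have hp : (s n, s (n + 1)) ∈ pairs n := by
        refine Finset.mem_filter.2 ⟨Finset.mem_product.2 ⟨hsS n, hsS (n + 1)⟩, ?_⟩
        have h1 := hsx n
        have h2 := hsx (n + 1)
        rw [pow_succ] at h2
        have h3 : (0 : ℝ) < (1 / 2) ^ n := by positivity
        change dist (s n) (s (n + 1)) ≤ _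
        linarith [dist_triangle_left (s n) (s (n + 1)) x]
      have h1 : (θ⁻¹ ^ n) ^ q * ‖u (s (n + 1)) ω - u (s n) ω‖ₑ ^ q ≤ Z ω := by
        refine le_trans ?_ le_add_self
        refine le_trans ?_ (ENNReal.le_tsum n)
        gcongr
        exact Finset.single_le_sum (f := fun p : E × E => ‖u p.2 ω - u p.1 ω‖ₑ ^ q)
          (fun _ _ => zero_le) hp
      rw [← ENNReal.mul_rpow_of_nonneg _ _ hq0.le, ← ENNReal.le_rpow_inv_iff hq0] at h1
      calc ‖u (s (n + 1)) ω - u (s n) ω‖ₑ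
          = θ ^ n * (θ⁻¹ ^ n * ‖u (s (n + 1)) ω - u (s n) ω‖ₑ) := by
            rw [← mul_assoc, ← mul_pow, ENNReal.mul_inv_cancel hθ0 hθt, one_pow, one_mul]
        _ ≤ _ := by gcongr
  have hpairint : ∀ n, ∫⁻ ω, (θ⁻¹ ^ n) ^ q * ∑ p ∈ pairs n, ‖u p.2 ω - u p.1 ω‖ₑ ^ q ∂P ≤
      (N₀ : ℝ≥0∞) ^ 2 * N * 6 ^ (β * q) * A * 2⁻¹ ^ n := by
    intro n
    have hm : ∀ p ∈ pairs n, AEMeasurable (fun ω => ‖u p.2 ω - u p.1 ω‖ₑ ^ q) P := by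
      intro p hp
      exact (((hmeas _ (hpD n p hp).2).sub (hmeas _ (hpD n p hp).1)).enorm).pow_const q
    rw [lintegral_const_mul'' _ (Finset.aemeasurable_fun_sum _ hm), lintegral_finsetSum' _ hm]
    have hone : ∀ p ∈ pairs n, ∫⁻ ω, ‖u p.2 ω - u p.1 ω‖ₑ ^ q ∂P ≤
        A * (6 * (2⁻¹ : ℝ≥0∞) ^ n) ^ (β * q) := by
      intro p hp
      refine (hincr _ (hpD n p hp).2 _ (hpD n p hp).1).trans ?_
      gcongr
      rw [edist_comm, edist_dist]
      refine (ENNReal.ofReal_le_ofReal (Finset.mem_filter.1 hp).2).trans (le_of_eq ?_)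
      rw [ENNReal.ofReal_mul (by norm_num), ENNReal.ofReal_pow (by norm_num), one_div,
        ENNReal.ofReal_inv_of_pos (by norm_num)]
      norm_num
    have hpc : ((pairs n).card : ℝ≥0∞) ≤ (N₀ : ℝ≥0∞) ^ 2 * N * ((N : ℝ≥0∞) ^ 2) ^ n := by
      have : (pairs n).card ≤ N₀ ^ 2 * N * (N ^ 2) ^ n := by
        calc (pairs n).card ≤ (S n ×ˢ S (n + 1)).card := Finset.card_filter_le _ _
          _ = (S n).card * (S (n + 1)).card := Finset.card_product _ _
          _ ≤ (N₀ * N ^ n) * (N₀ * N ^ (n + 1)) := Nat.mul_le_mul (hcard n) (hcard (n + 1))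
          _ = _ := by ring
      exact_mod_cast this
    -- the geometric decay of the chain beats the growth of the nets
    have hgeom : (θ⁻¹ ^ n) ^ q * (((N : ℝ≥0∞) ^ 2) ^ n * (2⁻¹ ^ n) ^ (β * q)) ≤ 2⁻¹ ^ n := by
      have e1 : (θ⁻¹ ^ n) ^ q = ((2 : ℝ≥0∞) ^ (β / 2 * q)) ^ n := by
        rw [hθ, ENNReal.rpow_neg, inv_inv, ← ENNReal.rpow_natCast, ← ENNReal.rpow_natCast,
          ← ENNReal.rpow_mul, ← ENNReal.rpow_mul, ← ENNReal.rpow_mul]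
        congr 1; ring
      have e2 : ((2⁻¹ : ℝ≥0∞) ^ n) ^ (β * q) = ((2 : ℝ≥0∞) ^ (-(β * q))) ^ n := by
        rw [ENNReal.rpow_neg, ← ENNReal.inv_rpow, ← ENNReal.rpow_natCast, ← ENNReal.rpow_natCast,
          ← ENNReal.rpow_mul, ← ENNReal.rpow_mul, mul_comm]
      rw [e1, e2, ← mul_pow, ← mul_pow]
      refine pow_le_pow_left' ?_ n
      have hN : (N : ℝ≥0∞) ^ 2 ≤ (2 : ℝ≥0∞) ^ ((2 * N : ℕ) : ℝ) := by
        rw [ENNReal.rpow_natCast, mul_comm, pow_mul]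
        refine pow_le_pow_left' ?_ 2
        exact_mod_cast Nat.lt_two_pow_self.le
      calc (2 : ℝ≥0∞) ^ (β / 2 * q) * ((N : ℝ≥0∞) ^ 2 * 2 ^ (-(β * q)))
          ≤ (2 : ℝ≥0∞) ^ (β / 2 * q) * (2 ^ ((2 * N : ℕ) : ℝ) * 2 ^ (-(β * q))) := by gcongr
        _ = 2 ^ (β / 2 * q + (((2 * N : ℕ) : ℝ) + -(β * q))) := by
            rw [← ENNReal.rpow_add _ _ (by norm_num) (by norm_num),
              ← ENNReal.rpow_add _ _ (by norm_num) (by norm_num)]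
        _ ≤ 2 ^ (-1 : ℝ) := by
            refine ENNReal.rpow_le_rpow_of_exponent_le (by norm_num) ?_
            push_cast
            linarith
        _ = 2⁻¹ := by rw [ENNReal.rpow_neg_one]
    calc (θ⁻¹ ^ n) ^ q * ∑ p ∈ pairs n, ∫⁻ ω, ‖u p.2 ω - u p.1 ω‖ₑ ^ q ∂P
        ≤ (θ⁻¹ ^ n) ^ q * ((pairs n).card • (A * (6 * (2⁻¹ : ℝ≥0∞) ^ n) ^ (β * q))) := by
          gcongr; exact Finset.sum_le_card_nsmul _ _ _ hone
      _ ≤ (θ⁻¹ ^ n) ^ q * ((N₀ : ℝ≥0∞) ^ 2 * N * ((N : ℝ≥0∞) ^ 2) ^ n *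
            (A * (6 * (2⁻¹ : ℝ≥0∞) ^ n) ^ (β * q))) := by
          rw [nsmul_eq_mul]; gcongr
      _ = (N₀ : ℝ≥0∞) ^ 2 * N * 6 ^ (β * q) * A *
            ((θ⁻¹ ^ n) ^ q * (((N : ℝ≥0∞) ^ 2) ^ n * (2⁻¹ ^ n) ^ (β * q))) := by
          rw [ENNReal.mul_rpow_of_nonneg _ _ (by positivity : 0 ≤ β * q)]; ring
      _ ≤ _ := by gcongr
  have hm0 : ∀ s ∈ S 0, AEMeasurable (fun ω => ‖u s ω‖ₑ ^ q) P := fun s hs =>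
    ((hmeas _ (hSD 0 hs)).enorm).pow_const q
  calc ∫⁻ ω, (⨆ x ∈ closure D, ‖u x ω‖ₑ) ^ q ∂P
      ≤ ∫⁻ ω, κ ^ q * Z ω ∂P := lintegral_mono_ae hpath
    _ = κ ^ q * ∫⁻ ω, Z ω ∂P := lintegral_const_mul' _ _ (ENNReal.rpow_ne_top_of_nonneg hq0.le hκt)
    _ ≤ κ ^ q * (N₀ * A + ∑' n, (N₀ : ℝ≥0∞) ^ 2 * N * 6 ^ (β * q) * A * 2⁻¹ ^ n) := by
        gcongr
        rw [hZ, lintegral_add_left' (Finset.aemeasurable_fun_sum _ hm0), lintegral_finsetSum' _ hm0,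
          lintegral_tsum]
        · gcongr with n
          · calc _ ≤ (S 0).card • A := Finset.sum_le_card_nsmul _ _ _ fun s hs => hval s (hSD 0 hs)
              _ ≤ N₀ * A := by
                rw [nsmul_eq_mul]
                gcongr
                simpa using hcard 0
          · exact hpairint n
        · intro n
          refine (Finset.aemeasurable_fun_sum _ fun p hp => ?_).const_mul _
          exact (((hmeas _ (hpD n p hp).2).sub (hmeas _ (hpD n p hp).1)).enorm).pow_const q
    _ = κ ^ q * B * A := by
        rw [ENNReal.tsum_mul_left, ENNReal.tsum_geometric, ENNReal.one_sub_inv_two, inv_inv, hB]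
        ring

end Chaining

/-! ### Gaussian moments and limits in `L²` -/

section GaussianMoments

variable {Ω : Type*} [MeasurableSpace Ω] {P : Measure Ω}

/-- All moments of a centred Gaussian variable are controlled by its standard deviation, with a
constant depending only on the exponent. -/
lemma exists_eLpNorm_sub_mean_le (P : Measure Ω) {q : ℝ≥0∞} (hq : q ≠ ⊤) :
    ∃ c : ℝ≥0, ∀ Y : Ω → ℝ, HasGaussianLaw Y P →
      eLpNorm (fun ω => Y ω - ∫ ω', Y ω' ∂P) q P ≤
        c * eLpNorm (fun ω => Y ω - ∫ ω', Y ω' ∂P) 2 P := by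
  set κ : ℝ≥0∞ → ℝ≥0∞ := fun r => eLpNorm id r (gaussianReal 0 1) with hκ
  have hκ2 : κ 2 ≠ 0 := by
    intro h
    rw [hκ, eLpNorm_eq_zero_iff aestronglyMeasurable_id (by norm_num)] at h
    have h1 := variance_congr h
    rw [variance_id_gaussianReal, variance_zero] at h1
    norm_num at h1
  have hκ2t : κ 2 ≠ ⊤ := (memLp_id_gaussianReal' 2 (by simp)).eLpNorm_ne_top
  have hκq : κ q ≠ ⊤ := (memLp_id_gaussianReal' q hq).eLpNorm_ne_top
  refine ⟨(κ q / κ 2).toNNReal, fun Y hY => ?_⟩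
  rw [ENNReal.coe_toNNReal (ENNReal.div_ne_top hκq hκ2)]
  set m := ∫ ω', Y ω' ∂P with hm
  set v := Var[Y; P].toNNReal with hv
  have hlaw : P.map (fun ω => Y ω - m) = (gaussianReal 0 1).map (fun z => (√(v : ℝ)) * z) := by
    rw [gaussianReal_map_const_mul, mul_zero]
    have h1 : P.map (fun ω => Y ω - m) = (P.map Y).map (fun y => y - m) := by
      rw [AEMeasurable.map_map_of_aemeasurable (by fun_prop) hY.aemeasurable]; rfl
    rw [h1, hY.map_eq_gaussianReal, gaussianReal_map_sub_const, sub_self]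
    congr 1
    ext
    simp [hv]
  have hr : ∀ r, eLpNorm (fun ω => Y ω - m) r P = ‖√(v : ℝ)‖ₑ * κ r := by
    intro r
    have h1 : eLpNorm (fun ω => Y ω - m) r P = eLpNorm id r (P.map (fun ω => Y ω - m)) := by
      rw [eLpNorm_map_measure aestronglyMeasurable_id (hY.aemeasurable.sub_const m)]; rfl
    rw [h1, hlaw, eLpNorm_map_measure aestronglyMeasurable_id (by fun_prop)]
    exact eLpNorm_const_smul (√(v : ℝ)) (id : ℝ → ℝ) r (gaussianReal 0 1)
  rw [hr q, hr 2, mul_comm (κ q / κ 2), mul_assoc, ENNReal.mul_div_cancel hκ2 hκ2t]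

/-- The moments of a Gaussian variable with arbitrary mean are controlled by its second moment. -/
lemma exists_eLpNorm_le_of_hasGaussianLaw (P : Measure Ω) [IsProbabilityMeasure P]
    {q : ℝ≥0∞} (hq : q ≠ ⊤) (hq1 : 1 ≤ q) :
    ∃ c : ℝ≥0, ∀ Y : Ω → ℝ, HasGaussianLaw Y P → eLpNorm Y q P ≤ c * eLpNorm Y 2 P := by
  obtain ⟨c, hc⟩ := exists_eLpNorm_sub_mean_le P hq
  refine ⟨c * 2 + 1, fun Y hY => ?_⟩
  have hYm := hY.aemeasurable.aestronglyMeasurable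
  set m := ∫ ω', Y ω' ∂P with hm
  have hmean : ‖m‖ₑ ≤ eLpNorm Y 2 P := by
    calc ‖m‖ₑ ≤ eLpNorm Y 1 P := by
          rw [eLpNorm_one_eq_lintegral_enorm]; exact enorm_integral_le_lintegral_enorm _
      _ ≤ eLpNorm Y 2 P := eLpNorm_le_eLpNorm_of_exponent_le (by norm_num) hYm
  have hconst : ∀ r : ℝ≥0∞, r ≠ 0 → eLpNorm (fun _ : Ω => m) r P = ‖m‖ₑ := by
    intro r hr
    rw [eLpNorm_const _ hr (NeZero.ne P)]; simp
  have h2 : eLpNorm (fun ω => Y ω - m) 2 P ≤ 2 * eLpNorm Y 2 P := by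
    calc eLpNorm (fun ω => Y ω - m) 2 P ≤ eLpNorm Y 2 P + eLpNorm (fun _ => m) 2 P :=
          eLpNorm_sub_le hYm aestronglyMeasurable_const (by norm_num)
      _ ≤ eLpNorm Y 2 P + eLpNorm Y 2 P := by rw [hconst 2 (by norm_num)]; gcongr
      _ = _ := by ring
  calc eLpNorm Y q P = eLpNorm ((fun ω => Y ω - m) + fun _ => m) q P := by
        congr 1; ext ω; simp
    _ ≤ eLpNorm (fun ω => Y ω - m) q P + eLpNorm (fun _ => m) q P :=
        eLpNorm_add_le (hYm.sub aestronglyMeasurable_const) aestronglyMeasurable_const hq1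
    _ ≤ c * (2 * eLpNorm Y 2 P) + eLpNorm Y 2 P := by
        rw [hconst q (by positivity)]
        gcongr
        exact (hc Y hY).trans (by gcongr)
    _ = _ := by push_cast; ring

/-- Gaussian variables that converge to zero almost surely converge to zero in `L²`: the part of the
second moment on the small set where the variable is large is absorbed, by the comparison of the
fourth and second moments. -/
lemma tendsto_eLpNorm_two_of_hasGaussianLaw [IsProbabilityMeasure P] {Y : ℕ → Ω → ℝ}
    (hY : ∀ n, HasGaussianLaw (Y n) P)
    (hlim : ∀ᵐ ω ∂P, Filter.Tendsto (fun n => Y n ω) Filter.atTop (nhds 0)) :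
    Filter.Tendsto (fun n => eLpNorm (Y n) 2 P) Filter.atTop (nhds 0) := by
  obtain ⟨c, hc⟩ := exists_eLpNorm_le_of_hasGaussianLaw P (q := 4) (by simp) (by norm_num)
  have hYm : ∀ n, AEStronglyMeasurable (Y n) P := fun n => (hY n).aemeasurable.aestronglyMeasurable
  have hprob := tendstoInMeasure_of_tendsto_ae (g := fun _ => (0 : ℝ)) hYm hlim
  rw [ENNReal.tendsto_nhds_zero]
  intro ε hε
  rcases eq_or_ne ε ⊤ with rfl | hεt
  · simp
  have hε2 : 0 < ε / 2 := ENNReal.half_pos hε.ne'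
  have hsmall : Filter.Tendsto (fun n => c * P {ω | ε / 2 ≤ edist (Y n ω) 0} ^ (1 / 4 : ℝ))
      Filter.atTop (nhds 0) := by
    have h1 := (ENNReal.continuous_rpow_const (y := (1 / 4 : ℝ))).tendsto 0 |>.comp
      (hprob (ε / 2) hε2)
    rw [ENNReal.zero_rpow_of_pos (by norm_num)] at h1
    simpa using ENNReal.Tendsto.const_mul h1 (Or.inr (ENNReal.coe_ne_top (r := c)))
  filter_upwards [(ENNReal.tendsto_nhds_zero.1 hsmall) 2⁻¹ (by simp)] with n hn
  set s := {ω | ε / 2 ≤ edist (Y n ω) 0} with hs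
  set t := toMeasurable P s with ht
  have htm : MeasurableSet t := measurableSet_toMeasurable P s
  have hfin : eLpNorm (Y n) 2 P ≠ ⊤ := ((hY n).memLp_two).eLpNorm_ne_top
  have hlarge : eLpNorm (t.indicator (Y n)) 2 P ≤ 2⁻¹ * eLpNorm (Y n) 2 P := by
    rw [eLpNorm_indicator_eq_eLpNorm_restrict htm]
    calc eLpNorm (Y n) 2 (P.restrict t)
        ≤ eLpNorm (Y n) 4 (P.restrict t) *
          (P.restrict t) Set.univ ^ (1 / (2 : ℝ≥0∞).toReal - 1 / (4 : ℝ≥0∞).toReal) :=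
          eLpNorm_le_eLpNorm_mul_rpow_measure_univ (by norm_num) (hYm n).restrict
      _ ≤ (c * eLpNorm (Y n) 2 P) * P s ^ (1 / 4 : ℝ) := by
          have hexp : 1 / (2 : ℝ≥0∞).toReal - 1 / (4 : ℝ≥0∞).toReal = 1 / 4 := by norm_num
          rw [Measure.restrict_apply_univ, ht, measure_toMeasurable, hexp]
          gcongr
          exact (eLpNorm_mono_measure _ Measure.restrict_le_self).trans (hc _ (hY n))
      _ = (c * P s ^ (1 / 4 : ℝ)) * eLpNorm (Y n) 2 P := by ring
      _ ≤ _ := by gcongr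
  have hrest : eLpNorm (tᶜ.indicator (Y n)) 2 P ≤ ε / 2 := by
    have h1 : ∀ᵐ ω ∂P, ‖tᶜ.indicator (Y n) ω‖ₑ ≤ ε / 2 := by
      refine Filter.Eventually.of_forall fun ω => ?_
      by_cases hω : ω ∈ t
      · simp [hω]
      · have h2 : ω ∉ s := fun h => hω (subset_toMeasurable P s h)
        rw [Set.indicator_of_mem (show ω ∈ tᶜ from hω), ← edist_zero_right]
        exact (not_le.1 h2).le
    refine (eLpNorm_le_of_ae_enorm_bound h1).trans ?_
    simp
  have hsum : eLpNorm (Y n) 2 P ≤ 2⁻¹ * eLpNorm (Y n) 2 P + ε / 2 := by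
    calc eLpNorm (Y n) 2 P = eLpNorm (t.indicator (Y n) + tᶜ.indicator (Y n)) 2 P := by
          rw [Set.indicator_self_add_compl]
      _ ≤ _ := eLpNorm_add_le ((hYm n).indicator htm) ((hYm n).indicator htm.compl) (by norm_num)
      _ ≤ _ := add_le_add hlarge hrest
  have hhalf : eLpNorm (Y n) 2 P = 2⁻¹ * eLpNorm (Y n) 2 P + 2⁻¹ * eLpNorm (Y n) 2 P := by
    rw [← add_mul, ENNReal.inv_two_add_inv_two, one_mul]
  have hle : 2⁻¹ * eLpNorm (Y n) 2 P ≤ 2⁻¹ * ε := by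
    rw [ENNReal.div_eq_inv_mul] at hsum
    exact (ENNReal.add_le_add_iff_left (ENNReal.mul_ne_top (by simp) hfin)).1
      (hhalf.symm.trans_le hsum)
  rwa [ENNReal.mul_le_mul_iff_right (by simp) (by simp)] at hle

/-- The closed linear span in `L²(P)` of the centred values of a Gaussian process inherits the
comparison of moments, since this comparison is stable under `L²` limits (Fatou). -/
lemma exists_eLpNorm_le_of_mem_closure_span (P : Measure Ω)
    {q : ℝ≥0∞} (hq : q ≠ ⊤) :
    ∃ c : ℝ≥0, ∀ {T : Type*} (X : T → Ω → ℝ), IsGaussianProcess X P →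
      ∀ H : T → Lp ℝ 2 P, (∀ t, H t =ᵐ[P] fun ω => X t ω - ∫ ω', X t ω' ∂P) →
      ∀ Z ∈ (Submodule.span ℝ (Set.range H)).topologicalClosure,
        eLpNorm Z q P ≤ c * ‖Z‖ₑ := by
  obtain ⟨c, hc⟩ := exists_eLpNorm_sub_mean_le P hq
  refine ⟨c, fun {T} X hX H hH Z hZ => ?_⟩
  have hspan : ∀ Z ∈ Submodule.span ℝ (Set.range H), eLpNorm Z q P ≤ c * ‖Z‖ₑ := by
    intro Z hZ
    obtain ⟨a, rfl⟩ := Finsupp.mem_span_range_iff_exists_finsupp.1 hZ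
    set Y : Ω → ℝ := fun ω => ∑ t ∈ a.support, a t • X t ω with hY
    have hYg : HasGaussianLaw Y P := (hX.smul a).hasGaussianLaw_fun_sum
    have hint : ∫ ω, Y ω ∂P = ∑ t ∈ a.support, a t * ∫ ω, X t ω ∂P := by
      rw [hY, integral_finsetSum]
      · simp only [smul_eq_mul, integral_const_mul]
      · exact fun t _ => ((hX.hasGaussianLaw_eval t).integrable).smul (a t)
    have hae : (a.sum fun t r => r • H t : Lp ℝ 2 P) =ᵐ[P] fun ω => Y ω - ∫ ω', Y ω' ∂P := by
      have h1 : ((∑ t ∈ a.support, a t • H t : Lp ℝ 2 P) : Ω → ℝ)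
          =ᵐ[P] fun ω => ∑ t ∈ a.support, (a t • H t : Lp ℝ 2 P) ω := by
        refine (Lp.coeFn_finsetSum _ _).trans (Filter.Eventually.of_forall fun ω => ?_)
        simp
      have h2 : ∀ᵐ ω ∂P, ∀ t ∈ a.support,
          (a t • H t : Lp ℝ 2 P) ω = a t * (X t ω - ∫ ω', X t ω' ∂P) := by
        rw [Filter.eventually_all_finset]
        intro t _
        filter_upwards [Lp.coeFn_smul (a t) (H t), hH t] with ω h3 h4
        rw [h3, Pi.smul_apply, h4, smul_eq_mul]
      filter_upwards [h1, h2] with ω h3 h4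
      rw [Finsupp.sum, h3, Finset.sum_congr rfl h4, hint, hY]
      simp only [mul_sub, Finset.sum_sub_distrib, smul_eq_mul]
    rw [Lp.enorm_def, eLpNorm_congr_ae hae, eLpNorm_congr_ae hae]
    exact hc Y hYg
  rw [← SetLike.mem_coe, Submodule.topologicalClosure_coe, mem_closure_iff_seq_limit] at hZ
  obtain ⟨z, hz, hlim⟩ := hZ
  obtain ⟨ns, hns, hae⟩ := (tendstoInMeasure_of_tendsto_Lp hlim).exists_seq_tendsto_ae
  have h1 := Lp.eLpNorm_lim_le_liminf_eLpNorm (p := q)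
    (fun n => (Lp.aestronglyMeasurable (z (ns n)))) Z hae
  refine h1.trans ?_
  have h2 : Filter.Tendsto (fun n => c * ‖z (ns n)‖ₑ) Filter.atTop (nhds (c * ‖Z‖ₑ)) := by
    refine ENNReal.Tendsto.const_mul ?_ (Or.inr ENNReal.coe_ne_top)
    exact (continuous_enorm.tendsto _).comp (hlim.comp hns.tendsto_atTop)
  rw [← h2.liminf_eq]
  exact Filter.liminf_le_liminf (Filter.Eventually.of_forall fun n => hspan _ (hz _))

end GaussianMoments

/-! ### The Karhunen–Loève expansion in a Hilbert space -/

section HilbertExpansion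

lemma integral_mem_of_isClosed {X F : Type*} [MeasurableSpace X] [NormedAddCommGroup F]
    [NormedSpace ℝ F] [CompleteSpace F] {ν : Measure X} [IsFiniteMeasure ν] {V : Submodule ℝ F}
    (hV : IsClosed (V : Set F)) {f : X → F} (hf : ∀ᵐ x ∂ν, f x ∈ V) : ∫ x, f x ∂ν ∈ V := by
  by_cases hint : Integrable f ν
  · rcases eq_or_ne ν 0 with rfl | hν
    · simp
    have : NeZero ν := ⟨hν⟩
    rw [← measure_smul_average]
    exact V.smul_mem _ (V.convex.average_mem hV hf hint)
  · rw [integral_undef hint]; exact V.zero_mem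

lemma isCompactOperator_smulRight {H : Type*} [NormedAddCommGroup H] [NormedSpace ℝ H]
    (φ : H →L[ℝ] ℝ) (v : H) : IsCompactOperator (φ.smulRight v : H →L[ℝ] H) := by
  have hid : IsCompactOperator (id : ℝ → ℝ) :=
    (isCompactOperator_id_iff_finiteDimensional (𝕜 := ℝ)).2 inferInstance
  have h : IsCompactOperator (φ : H → ℝ) := hid.comp_clm φ
  exact h.clm_comp (ContinuousLinearMap.toSpanSingleton ℝ v)

variable {H : Type*} [NormedAddCommGroup H] [InnerProductSpace ℝ H] [CompleteSpace H]

variable {X : Type*} [TopologicalSpace X] [MeasurableSpace X] [OpensMeasurableSpace X]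
  [SecondCountableTopology X]
  {ν : Measure X} {D : Set X}

/-- A continuous bounded family of vectors whose covariance operator `∫ w ⊗ w` has no nonzero
eigenvalue vanishes: the operator is compact and self-adjoint, so that the absence of nonzero
eigenvalues makes it zero. -/
lemma eq_zero_of_forall_eigenvector_eq_zero [ν.IsOpenPosMeasure] (hD : IsOpen D) (hDν : ν D ≠ ⊤)
    {w : X → H} (hw : ContinuousOn w D) {B : ℝ} (hB : ∀ x ∈ D, ‖w x‖ ≤ B)
    (heig : ∀ (μ : ℝ) (Z : H), μ ≠ 0 → ∫ y in D, inner ℝ (w y) Z • w y ∂ν = μ • Z → Z = 0) :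
    ∀ x ∈ D, w x = 0 := by
  have hfin : IsFiniteMeasure (ν.restrict D) := ⟨by simpa using hDν.lt_top⟩
  set k : X → H →L[ℝ] H := fun y => (innerSL ℝ (w y)).smulRight (w y) with hk
  have hkc : ContinuousOn k D := by
    have h1 : ContinuousOn (fun y => innerSL ℝ (w y)) D :=
      (innerSL ℝ).continuous.comp_continuousOn hw
    exact ((ContinuousLinearMap.smulRightL ℝ H H).continuous.comp_continuousOn h1).clm_apply hw
  have hkint : Integrable k (ν.restrict D) := by
    refine Integrable.of_bound (hkc.aestronglyMeasurable hD.measurableSet) (B * B) ?_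
    refine (ae_restrict_iff' hD.measurableSet).2 (Filter.Eventually.of_forall fun y hy => ?_)
    rw [hk]
    simp only [ContinuousLinearMap.norm_smulRight_apply, innerSL_apply_norm]
    have := hB y hy
    have := norm_nonneg (w y)
    gcongr
    linarith
  set S : H →L[ℝ] H := ∫ y in D, k y ∂ν with hS
  have hSapply : ∀ Z, S Z = ∫ y in D, inner ℝ (w y) Z • w y ∂ν := by
    intro Z
    rw [hS, ContinuousLinearMap.integral_apply hkint]
    rfl
  have hint : ∀ Z, Integrable (fun y => inner ℝ (w y) Z • w y) (ν.restrict D) := fun Z =>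
    hkint.apply_continuousLinearMap Z
  have hSinner : ∀ Z Y, inner ℝ (S Z) Y = ∫ y in D, inner ℝ (w y) Z * inner ℝ (w y) Y ∂ν := by
    intro Z Y
    rw [hSapply, real_inner_comm, ← integral_inner (hint Z)]
    refine integral_congr_ae (Filter.Eventually.of_forall fun y => ?_)
    simp only [inner_smul_right, real_inner_comm]
  have hScomp : IsCompactOperator S := by
    have hcl : IsClosed (compactOperator (RingHom.id ℝ) H H : Set (H →L[ℝ] H)) :=
      isClosed_setOfPred_isCompactOperator (σ₁₂ := RingHom.id ℝ) (M₁ := H) (M₂ := H)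
    exact integral_mem_of_isClosed hcl (Filter.Eventually.of_forall fun y =>
      isCompactOperator_smulRight _ _)
  have hSsymm : S.IsSymmetric := by
    intro Z Y
    change inner ℝ (S Z) Y = inner ℝ Z (S Y)
    rw [real_inner_comm (S Y), hSinner, hSinner]
    simp only [mul_comm]
  have hS0 : S = 0 := by
    refine (ContinuousLinearMap.eq_zero_of_forall_hasEigenvalue_eq_zero hScomp hSsymm).1 ?_
    intro μ hμ
    by_contra hne
    obtain ⟨Z, hZ⟩ := hμ.exists_hasEigenvector
    exact hZ.2 (heig μ Z hne ((hSapply Z).symm.trans hZ.apply_eq_smul))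
  intro x hx
  have hcx : ContinuousOn (fun y => inner ℝ (w y) (w x)) D := hw.inner continuousOn_const
  have h0 : ∫ y in D, inner ℝ (w y) (w x) * inner ℝ (w y) (w x) ∂ν = 0 := by
    rw [← hSinner, hS0]; simp
  have hi : Integrable (fun y => inner ℝ (w y) (w x) * inner ℝ (w y) (w x)) (ν.restrict D) := by
    refine ((hint (w x)).inner_const (w x)).congr (Filter.Eventually.of_forall fun y => ?_)
    simp only [real_inner_smul_left]
  rw [integral_eq_zero_iff_of_nonneg (fun y => mul_self_nonneg _) hi] at h0
  have h1 := Measure.eqOn_open_of_ae_eq h0 hD (hcx.mul hcx) continuousOn_const hx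
  simpa using h1

/-- Completeness of the Karhunen–Loève coefficients: if the eigenfunctions `b m` exhaust the nonzero
spectrum of the covariance operator, every vector `h x` lies in the closed span of the vectors
`∫ b m • h`. -/
lemma mem_closure_span_of_exhaustive [ν.IsOpenPosMeasure] (hD : IsOpen D) (hDν : ν D ≠ ⊤)
    {h : X → H} (hh : ContinuousOn h D) {B : ℝ} (hB : ∀ x ∈ D, ‖h x‖ ≤ B)
    {b : ℕ → X → ℝ} (hb : ∀ m, IntegrableOn (b m) D ν) {lam : ℕ → ℝ}
    (heigen : ∀ m, ∀ x ∈ D, inner ℝ (h x) (∫ y in D, b m y • h y ∂ν) = lam m * b m x)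
    (hexh : ∀ (μ : ℝ) (f : X → ℝ), μ ≠ 0 → MemLp f 2 (ν.restrict D) →
      (∀ x ∈ D, ∫ y in D, inner ℝ (h x) (h y) * f y ∂ν = μ * f x) →
      (∀ m, ∫ x in D, f x * b m x ∂ν = 0) → f =ᵐ[ν.restrict D] 0) :
    ∀ x ∈ D, h x ∈
      (Submodule.span ℝ (Set.range fun m => ∫ y in D, b m y • h y ∂ν)).topologicalClosure := by
  have hfin : IsFiniteMeasure (ν.restrict D) := ⟨by simpa using hDν.lt_top⟩
  set η : ℕ → H := fun m => ∫ y in D, b m y • h y ∂ν with hη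
  set W := (Submodule.span ℝ (Set.range η))ᗮ with hW
  have hWη : ∀ Z, Z ∈ W ↔ ∀ m, inner ℝ (η m) Z = 0 := by
    intro Z
    rw [hW, Submodule.mem_orthogonal]
    refine ⟨fun hZ m => hZ _ (Submodule.subset_span ⟨m, rfl⟩), fun hZ u hu => ?_⟩
    induction hu using Submodule.span_induction with
    | mem u hu => obtain ⟨m, rfl⟩ := hu; exact hZ m
    | zero => simp
    | add u v _ _ hu hv => rw [inner_add_left, hu, hv, add_zero]
    | smul a u _ hu => rw [real_inner_smul_left, hu, mul_zero]
  have hhm : AEStronglyMeasurable h (ν.restrict D) := hh.aestronglyMeasurable hD.measurableSet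
  have hhB : ∀ᵐ y ∂ν.restrict D, ‖h y‖ ≤ B :=
    (ae_restrict_iff' hD.measurableSet).2 (Filter.Eventually.of_forall hB)
  have hbint : ∀ m, Integrable (fun y => b m y • h y) (ν.restrict D) := fun m =>
    (hb m).smul_bdd B hhm hhB
  have hfint : ∀ Z, Integrable (fun y => inner ℝ (h y) Z • h y) (ν.restrict D) := by
    intro Z
    exact ((Integrable.of_bound hhm B hhB).inner_const Z).smul_bdd B hhm hhB
  have hηinner : ∀ m Z, inner ℝ (η m) Z = ∫ y in D, inner ℝ (h y) Z * b m y ∂ν := by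
    intro m Z
    rw [hη, real_inner_comm, ← integral_inner (hbint m)]
    refine integral_congr_ae (Filter.Eventually.of_forall fun y => ?_)
    simp only [inner_smul_right, real_inner_comm, mul_comm]
  suffices hw : ∀ x ∈ D, W.starProjection (h x) = 0 by
    intro x hx
    rw [← Submodule.orthogonal_orthogonal_eq_closure]
    exact (Submodule.starProjection_apply_eq_zero_iff _).1 (hw x hx)
  refine eq_zero_of_forall_eigenvector_eq_zero hD hDν (B := B)
    (W.starProjection.continuous.comp_continuousOn hh) (fun x hx =>
      (W.norm_starProjection_apply_le (h x)).trans (hB x hx)) ?_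
  intro μ Z hμ hZ
  have hZW : Z ∈ W := by
    have h1 : μ • Z ∈ W := by
      rw [← hZ]
      exact integral_mem_of_isClosed (Submodule.isClosed_orthogonal _)
        (Filter.Eventually.of_forall fun y => W.smul_mem _ (W.starProjection_apply_mem _))
    exact (W.smul_mem_iff hμ).1 h1
  have hproj : ∀ v, inner ℝ (W.starProjection v) Z = inner ℝ v Z := by
    intro v
    rw [W.inner_starProjection_left_eq_right, Submodule.starProjection_eq_self_iff.2 hZW]
  set V : H := ∫ y in D, inner ℝ (h y) Z • h y ∂ν with hV
  -- `W` is invariant under the covariance operator of `h`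
  have hVW : V ∈ W := by
    rw [hWη]
    intro m
    rw [hV, ← integral_inner (hfint Z)]
    have h1 : ∫ y in D, inner ℝ (η m) (inner ℝ (h y) Z • h y) ∂ν
        = ∫ y in D, lam m * (inner ℝ (h y) Z * b m y) ∂ν := by
      refine setIntegral_congr_fun hD.measurableSet fun y hy => ?_
      simp only [inner_smul_right]
      rw [real_inner_comm (h y) (η m), heigen m y hy]
      ring
    rw [h1, integral_const_mul, ← hηinner, (hWη Z).1 hZW m, mul_zero]
  have hVZ : V = μ • Z := by
    rw [← hZ, ← Submodule.starProjection_eq_self_iff.2 hVW, hV,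
      ← ContinuousLinearMap.integral_comp_comm _ (hfint Z)]
    simp only [map_smul, hproj]
  have hf0 := hexh μ (fun y => inner ℝ (h y) Z) hμ
    (MemLp.of_bound (hhm.inner_const) (B * ‖Z‖) (by
      filter_upwards [hhB] with y hy
      exact (norm_inner_le_norm _ _).trans (by gcongr)))
    (fun x hx => by
      have h1 : inner ℝ (h x) V = μ * inner ℝ (h x) Z := by rw [hVZ, inner_smul_right]
      rw [← h1, hV, ← integral_inner (hfint Z)]
      refine integral_congr_ae (Filter.Eventually.of_forall fun y => ?_)
      simp only [inner_smul_right, mul_comm])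
    (fun m => by rw [← hηinner]; exact (hWη Z).1 hZW m)
  have hV0 : V = 0 := by
    rw [hV]
    refine integral_eq_zero_of_ae ?_
    filter_upwards [hf0] with y hy
    have hy' : inner ℝ (h y) Z = 0 := hy
    simp [hy']
  rw [hV0] at hVZ
  exact (smul_eq_zero.1 hVZ.symm).resolve_left hμ

omit [CompleteSpace H] in
/-- The remainder of an orthogonal expansion is bounded by the tail of the squared coefficients. -/
lemma enorm_sub_sum_sq_le_tsum {η : ℕ → H} {lam c : ℕ → ℝ}
    (hη : ∀ m n, inner ℝ (η m) (η n) = if m = n then lam m else 0) {v : H}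
    (hv : v ∈ (Submodule.span ℝ (Set.range η)).topologicalClosure)
    (hc : ∀ m, inner ℝ v (η m) = lam m * c m) (M : ℕ) :
    ‖v - ∑ m ∈ Finset.range M, c m • η m‖ₑ ^ 2 ≤
      ∑' m, ENNReal.ofReal (lam (m + M)) * ‖c (m + M)‖ₑ ^ 2 := by
  set s : ℕ → H := fun N => ∑ m ∈ Finset.range N, c m • η m with hs
  have hlam : ∀ m, 0 ≤ lam m := by
    intro m
    have := hη m m
    rw [if_pos rfl] at this
    rw [← this]
    exact real_inner_self_nonneg
  have hsη : ∀ N m, m < N → inner ℝ (v - s N) (η m) = 0 := by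
    intro N m hm
    rw [inner_sub_left, hc, hs, sum_inner]
    simp only [real_inner_smul_left, hη]
    simp [hm, mul_comm]
  have hbest : ∀ N, ∀ u ∈ Submodule.span ℝ (η '' (Finset.range N : Set ℕ)),
      ‖v - s N‖ ≤ ‖v - u‖ := by
    intro N u hu
    have hsu : s N - u ∈ Submodule.span ℝ (η '' (Finset.range N : Set ℕ)) := by
      refine Submodule.sub_mem _ (Submodule.sum_mem _ fun m hm => Submodule.smul_mem _ _ ?_) hu
      exact Submodule.subset_span ⟨m, hm, rfl⟩
    have horth : inner ℝ (v - s N) (s N - u) = 0 := by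
      generalize s N - u = z at hsu
      induction hsu using Submodule.span_induction with
      | mem z hz =>
        obtain ⟨m, hm, rfl⟩ := hz
        exact hsη N m (Finset.mem_range.1 hm)
      | zero => simp
      | add u v _ _ hu hv => rw [inner_add_right, hu, hv, add_zero]
      | smul a u _ hu => rw [inner_smul_right, hu, mul_zero]
    have h1 : v - u = (v - s N) + (s N - u) := by abel
    have h2 := norm_add_sq_eq_norm_sq_add_norm_sq_of_inner_eq_zero (v - s N) (s N - u) horth
    rw [← h1] at h2
    nlinarith [norm_nonneg (v - s N), norm_nonneg (v - u), mul_self_nonneg ‖s N - u‖]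
  have hlim : Filter.Tendsto s Filter.atTop (nhds v) := by
    rw [Metric.tendsto_atTop]
    intro ε hε
    rw [← SetLike.mem_coe, Submodule.topologicalClosure_coe, Metric.mem_closure_iff] at hv
    obtain ⟨u, hu, hvu⟩ := hv ε hε
    obtain ⟨a, rfl⟩ := Finsupp.mem_span_range_iff_exists_finsupp.1 hu
    obtain ⟨N, hN⟩ := a.support.exists_nat_subset_range
    refine ⟨N, fun n hn => ?_⟩
    rw [dist_comm, dist_eq_norm]
    refine lt_of_le_of_lt (hbest n _ ?_) (by rwa [dist_eq_norm] at hvu)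
    refine Submodule.sum_mem _ fun m hm =>
      Submodule.smul_mem _ _ (Submodule.subset_span ⟨m, ?_, rfl⟩)
    have := Finset.mem_range.1 (hN hm)
    simp only [Finset.coe_range, Set.mem_Iio]
    omega
  have hpyth : ∀ N, ‖s (N + M) - s M‖ₑ ^ 2 =
      ∑ m ∈ Finset.range N, ENNReal.ofReal (lam (m + M)) * ‖c (m + M)‖ₑ ^ 2 := by
    intro N
    have h1 : s (N + M) - s M = ∑ m ∈ Finset.range N, c (m + M) • η (m + M) := by
      simp only [hs, add_comm N M, Finset.sum_range_add_sub_sum_range, add_comm _ M]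
    have h2 : ‖s (N + M) - s M‖ ^ 2 = ∑ m ∈ Finset.range N, lam (m + M) * c (m + M) ^ 2 := by
      rw [h1, ← real_inner_self_eq_norm_sq, sum_inner]
      refine Finset.sum_congr rfl fun m hm => ?_
      rw [inner_sum]
      simp only [real_inner_smul_left, inner_smul_right, hη, add_left_inj]
      rw [Finset.sum_eq_single_of_mem m hm (fun n _ hne => by simp [hne.symm])]
      simp only [if_true]
      ring
    rw [← ofReal_norm, ← ENNReal.ofReal_pow (norm_nonneg _), h2, ENNReal.ofReal_sum_of_nonneg
      (fun m _ => mul_nonneg (hlam _) (sq_nonneg _))]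
    refine Finset.sum_congr rfl fun m _ => ?_
    rw [ENNReal.ofReal_mul (hlam _), ← ofReal_norm, ← ENNReal.ofReal_pow (norm_nonneg _),
      Real.norm_eq_abs, sq_abs]
  have hlim' : Filter.Tendsto (fun N => ‖s (N + M) - s M‖ₑ ^ 2) Filter.atTop
      (nhds (‖v - s M‖ₑ ^ 2)) := by
    refine ((ENNReal.continuous_pow 2).tendsto _).comp ((continuous_enorm.tendsto _).comp ?_)
    exact ((Filter.tendsto_add_atTop_iff_nat M).2 hlim).sub_const _
  refine le_of_tendsto' hlim' fun N => ?_
  rw [hpyth]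
  exact ENNReal.sum_le_tsum _

end HilbertExpansion

/-! ### The centred field as a curve in `L²(P)` -/

section CentredField

variable {d : ℕ} {Ω : Type*} [MeasurableSpace Ω] {P : Measure Ω}
  {D : Set (EuclideanSpace ℝ (Fin d))} {g : EuclideanSpace ℝ (Fin d) → Ω → ℝ}

lemma IsContinuousGaussianField.hasGaussianLaw (hg : IsContinuousGaussianField D g P)
    {x : EuclideanSpace ℝ (Fin d)} (hx : x ∈ closure D) : HasGaussianLaw (g x) P :=
  hg.gaussian.hasGaussianLaw_eval (⟨x, hx⟩ : closure D)

lemma IsContinuousGaussianField.hasGaussianLaw_sub (hg : IsContinuousGaussianField D g P)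
    {x y : EuclideanSpace ℝ (Fin d)} (hx : x ∈ closure D) (hy : y ∈ closure D) :
    HasGaussianLaw (fun ω => g x ω - g y ω) P :=
  hg.gaussian.hasGaussianLaw_fun_sub (s := (⟨x, hx⟩ : closure D)) (t := ⟨y, hy⟩)

/-- Almost sure continuity of the paths of a Gaussian field implies continuity in mean square. -/
lemma IsContinuousGaussianField.tendsto_eLpNorm_sub [IsProbabilityMeasure P]
    (hg : IsContinuousGaussianField D g P) {x : EuclideanSpace ℝ (Fin d)} (hx : x ∈ closure D) :
    Filter.Tendsto (fun y => eLpNorm (fun ω => g y ω - g x ω) 2 P) (nhdsWithin x (closure D))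
      (nhds 0) := by
  refine Filter.tendsto_of_seq_tendsto fun u hu => ?_
  obtain ⟨hux, hmem⟩ := tendsto_nhdsWithin_iff.1 hu
  obtain ⟨N, hN⟩ := Filter.eventually_atTop.1 hmem
  rw [← Filter.tendsto_add_atTop_iff_nat N]
  refine tendsto_eLpNorm_two_of_hasGaussianLaw
    (fun n => hg.hasGaussianLaw_sub (hN (n + N) (by omega)) hx) ?_
  filter_upwards [hg.continuous_paths] with ω hω
  have h1 : Filter.Tendsto (fun n => g (u (n + N)) ω) Filter.atTop (nhds (g x ω)) :=
    (Filter.tendsto_add_atTop_iff_nat N).2 ((hω x hx).tendsto.comp hu)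
  simpa using h1.sub_const (g x ω)

lemma IsContinuousGaussianField.enorm_mean_sub_le [IsProbabilityMeasure P]
    (hg : IsContinuousGaussianField D g P) {x y : EuclideanSpace ℝ (Fin d)}
    (hx : x ∈ closure D) (hy : y ∈ closure D) :
    ‖mean g P y - mean g P x‖ₑ ≤ eLpNorm (fun ω => g y ω - g x ω) 2 P := by
  rw [mean, mean,
    ← integral_sub (hg.hasGaussianLaw hy).integrable (hg.hasGaussianLaw hx).integrable]
  refine (enorm_integral_le_lintegral_enorm _).trans ?_
  rw [← eLpNorm_one_eq_lintegral_enorm]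
  exact eLpNorm_le_eLpNorm_of_exponent_le (by norm_num)
    (hg.hasGaussianLaw_sub hy hx).aemeasurable.aestronglyMeasurable

lemma IsContinuousGaussianField.continuousOn_mean [IsProbabilityMeasure P]
    (hg : IsContinuousGaussianField D g P) : ContinuousOn (mean g P) (closure D) := by
  intro x hx
  rw [ContinuousWithinAt, tendsto_iff_edist_tendsto_0]
  refine tendsto_of_tendsto_of_tendsto_of_le_of_le' tendsto_const_nhds (hg.tendsto_eLpNorm_sub hx)
    (Filter.Eventually.of_forall fun _ => zero_le) ?_
  filter_upwards [self_mem_nhdsWithin] with y hy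
  rw [edist_eq_enorm_sub]
  exact hg.enorm_mean_sub_le hx hy

open Classical in
/-- The centred value `g x - E[g x]` as an element of `L²(P)`; zero where it is not square
integrable, which does not happen on `closure D`. -/
noncomputable def centredField (g : EuclideanSpace ℝ (Fin d) → Ω → ℝ) (P : Measure Ω)
    (x : EuclideanSpace ℝ (Fin d)) : Lp ℝ 2 P :=
  if h : MemLp (fun ω => g x ω - mean g P x) 2 P then h.toLp _ else 0

lemma IsContinuousGaussianField.centredField_ae_eq [IsProbabilityMeasure P]
    (hg : IsContinuousGaussianField D g P) {x : EuclideanSpace ℝ (Fin d)} (hx : x ∈ closure D) :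
    centredField g P x =ᵐ[P] fun ω => g x ω - mean g P x := by
  have h : MemLp (fun ω => g x ω - mean g P x) 2 P :=
    (hg.hasGaussianLaw hx).memLp_two.sub (memLp_const _)
  rw [centredField, dif_pos h]
  exact h.coeFn_toLp

lemma IsContinuousGaussianField.continuousOn_centredField [IsProbabilityMeasure P]
    (hg : IsContinuousGaussianField D g P) : ContinuousOn (centredField g P) (closure D) := by
  intro x hx
  rw [ContinuousWithinAt, tendsto_iff_edist_tendsto_0]
  have hlim := (ENNReal.Tendsto.const_mul (hg.tendsto_eLpNorm_sub hx)
    (Or.inr (by norm_num : (2 : ℝ≥0∞) ≠ ⊤)))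
  rw [mul_zero] at hlim
  refine tendsto_of_tendsto_of_tendsto_of_le_of_le' tendsto_const_nhds hlim
    (Filter.Eventually.of_forall fun _ => zero_le) ?_
  filter_upwards [self_mem_nhdsWithin] with y hy
  have hm := (hg.hasGaussianLaw_sub hy hx).aemeasurable.aestronglyMeasurable
  have hae : (centredField g P y - centredField g P x : Ω → ℝ) =ᵐ[P]
      (fun ω => g y ω - g x ω) - fun _ => mean g P y - mean g P x := by
    filter_upwards [hg.centredField_ae_eq hx, hg.centredField_ae_eq hy] with ω h1 h2
    simp only [Pi.sub_apply, h1, h2]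
    ring
  calc edist (centredField g P y) (centredField g P x)
      = eLpNorm ((fun ω => g y ω - g x ω) - fun _ => mean g P y - mean g P x) 2 P := by
        rw [Lp.edist_def, eLpNorm_congr_ae hae]
    _ ≤ eLpNorm (fun ω => g y ω - g x ω) 2 P + eLpNorm (fun _ : Ω => mean g P y - mean g P x) 2 P :=
        eLpNorm_sub_le hm aestronglyMeasurable_const (by norm_num)
    _ ≤ eLpNorm (fun ω => g y ω - g x ω) 2 P + eLpNorm (fun ω => g y ω - g x ω) 2 P := by
        gcongr
        rw [eLpNorm_const _ (by norm_num) (NeZero.ne P)]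
        simpa using hg.enorm_mean_sub_le hx hy
    _ = _ := by ring

lemma IsContinuousGaussianField.inner_centredField [IsProbabilityMeasure P]
    (hg : IsContinuousGaussianField D g P) {x y : EuclideanSpace ℝ (Fin d)}
    (hx : x ∈ closure D) (hy : y ∈ closure D) :
    inner ℝ (centredField g P x) (centredField g P y) = cov[g x, g y; P] := by
  rw [L2.inner_def, covariance]
  refine integral_congr_ae ?_
  filter_upwards [hg.centredField_ae_eq hx, hg.centredField_ae_eq hy] with ω h1 h2
  rw [h1, h2]
  simp only [RCLike.inner_apply, conj_trivial, mean]
  ring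

lemma IsContinuousGaussianField.exists_norm_centredField_le [IsProbabilityMeasure P]
    (hD : Bornology.IsBounded D) (hg : IsContinuousGaussianField D g P) :
    ∃ B : ℝ, ∀ x ∈ closure D, ‖centredField g P x‖ ≤ B :=
  hD.isCompact_closure.exists_bound_of_continuousOn hg.continuousOn_centredField

/-- Joint measurability: the field is the almost everywhere limit of its compositions with simple
functions that approximate the identity of `D`. -/
lemma IsContinuousGaussianField.aestronglyMeasurable_uncurry [SFinite P] (hDo : IsOpen D)
    (hDn : D.Nonempty) (hg : IsContinuousGaussianField D g P) :
    AEStronglyMeasurable (fun p : EuclideanSpace ℝ (Fin d) × Ω => g p.1 p.2)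
      ((volume.restrict D).prod P) := by
  classical
  obtain ⟨y₀, hy₀⟩ := hDn
  set π : ℕ → SimpleFunc (EuclideanSpace ℝ (Fin d)) (EuclideanSpace ℝ (Fin d)) :=
    SimpleFunc.approxOn id measurable_id D y₀ hy₀ with hπ
  have hπD : ∀ n x, π n x ∈ D := fun n x => SimpleFunc.approxOn_mem measurable_id hy₀ n x
  refine aestronglyMeasurable_of_tendsto_ae Filter.atTop
    (f := fun n (p : EuclideanSpace ℝ (Fin d) × Ω) => g (π n p.1) p.2) (fun n => ?_) ?_
  · have heq : (fun p : EuclideanSpace ℝ (Fin d) × Ω => g (π n p.1) p.2) = fun p =>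
        ∑ z ∈ (π n).range, (π n ⁻¹' {z}).indicator (fun _ => (1 : ℝ)) p.1 * g z p.2 := by
      funext p
      rw [Finset.sum_eq_single_of_mem (π n p.1) ((π n).mem_range_self p.1)]
      · simp
      · intro z _ hz
        rw [Set.indicator_of_notMem (by simpa using hz.symm), zero_mul]
    rw [heq]
    refine Finset.aestronglyMeasurable_fun_sum _ fun z hz => ?_
    obtain ⟨x, rfl⟩ := SimpleFunc.mem_range.1 hz
    have h1 : StronglyMeasurable
        ((π n ⁻¹' {π n x}).indicator (fun _ : EuclideanSpace ℝ (Fin d) => (1 : ℝ))) :=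
      stronglyMeasurable_const.indicator ((π n).measurableSet_fiber _)
    have h2 : AEStronglyMeasurable (g (π n x)) P :=
      (hg.hasGaussianLaw (subset_closure (hπD n x))).aemeasurable.aestronglyMeasurable
    exact (h1.aestronglyMeasurable.comp_fst).mul h2.comp_snd
  · have h1 : ∀ᵐ p ∂(volume.restrict D).prod P, p.1 ∈ D :=
      Measure.quasiMeasurePreserving_fst.ae (ae_restrict_mem hDo.measurableSet)
    have h2 : ∀ᵐ p ∂(volume.restrict D).prod P, ContinuousOn (fun x => g x p.2) (closure D) :=
      Measure.quasiMeasurePreserving_snd.ae hg.continuous_paths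
    filter_upwards [h1, h2] with p hp1 hp2
    refine (hp2 p.1 (subset_closure hp1)).tendsto.comp ?_
    refine tendsto_nhdsWithin_iff.2 ⟨?_, Filter.Eventually.of_forall fun n =>
      subset_closure (hπD n _)⟩
    exact SimpleFunc.tendsto_approxOn measurable_id hy₀ (subset_closure hp1)

lemma IsContinuousGaussianField.integrable_sub_mean_mul [IsProbabilityMeasure P]
    (hDo : IsOpen D) (hDn : D.Nonempty) (hDb : Bornology.IsBounded D)
    (hg : IsContinuousGaussianField D g P)
    {f : EuclideanSpace ℝ (Fin d) → ℝ} (hf : IntegrableOn f D) :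
    Integrable (fun p : EuclideanSpace ℝ (Fin d) × Ω => (g p.1 p.2 - mean g P p.1) * f p.1)
      ((volume.restrict D).prod P) := by
  obtain ⟨B, hB⟩ := hg.exists_norm_centredField_le hDb
  have hmean : AEStronglyMeasurable (mean g P) (volume.restrict D) :=
    (hg.continuousOn_mean.mono subset_closure).aestronglyMeasurable hDo.measurableSet
  have hmeas : AEStronglyMeasurable (fun p : EuclideanSpace ℝ (Fin d) × Ω =>
      (g p.1 p.2 - mean g P p.1) * f p.1) ((volume.restrict D).prod P) :=
    ((hg.aestronglyMeasurable_uncurry hDo hDn).sub hmean.comp_fst).mul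
      hf.aestronglyMeasurable.comp_fst
  rw [integrable_prod_iff hmeas]
  refine ⟨?_, ?_⟩
  · filter_upwards [ae_restrict_mem hDo.measurableSet] with x hx
    have hgx := (hg.hasGaussianLaw (subset_closure hx)).integrable
    exact (hgx.sub (integrable_const _)).mul_const _
  · refine Integrable.mono' (hf.norm.const_mul B) hmeas.norm.integral_prod_right' ?_
    filter_upwards [ae_restrict_mem hDo.measurableSet] with x hx
    have hx' := subset_closure hx
    rw [Real.norm_of_nonneg (integral_nonneg fun _ => norm_nonneg _)]
    simp only [norm_mul]
    rw [integral_mul_const]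
    gcongr
    have h1 : ∫ ω, ‖g x ω - mean g P x‖ ∂P = (eLpNorm (centredField g P x) 1 P).toReal := by
      rw [eLpNorm_congr_ae (hg.centredField_ae_eq hx'), integral_norm_eq_lintegral_enorm,
        eLpNorm_one_eq_lintegral_enorm]
      exact ((hg.hasGaussianLaw hx').integrable.sub (integrable_const _)).aestronglyMeasurable
    rw [h1]
    refine le_trans ?_ (hB x hx')
    rw [Lp.norm_def]
    exact ENNReal.toReal_mono (Lp.eLpNorm_ne_top _)
      (eLpNorm_le_eLpNorm_of_exponent_le (by norm_num) (Lp.aestronglyMeasurable _))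

lemma IsContinuousGaussianField.integrable_smul_centredField [IsProbabilityMeasure P]
    (hDo : IsOpen D) (hDb : Bornology.IsBounded D) (hg : IsContinuousGaussianField D g P)
    {f : EuclideanSpace ℝ (Fin d) → ℝ} (hf : IntegrableOn f D) :
    Integrable (fun y => f y • centredField g P y) (volume.restrict D) := by
  obtain ⟨B, hB⟩ := hg.exists_norm_centredField_le hDb
  refine hf.smul_bdd B ?_ ?_
  · exact (hg.continuousOn_centredField.mono subset_closure).aestronglyMeasurable hDo.measurableSet
  · exact (ae_restrict_iff' hDo.measurableSet).2
      (Filter.Eventually.of_forall fun y hy => hB y (subset_closure hy))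

/-- The pathwise integral of the centred field against `f` represents the Bochner integral in
`L²(P)`: by Fubini's theorem, both have the same integral over each event. -/
lemma IsContinuousGaussianField.setIntegral_smul_centredField_ae_eq [IsProbabilityMeasure P]
    (hDo : IsOpen D) (hDn : D.Nonempty) (hDb : Bornology.IsBounded D)
    (hg : IsContinuousGaussianField D g P)
    {f : EuclideanSpace ℝ (Fin d) → ℝ} (hf : IntegrableOn f D) :
    (∫ y in D, f y • centredField g P y : Lp ℝ 2 P) =ᵐ[P]
      fun ω => ∫ y in D, (g y ω - mean g P y) * f y := by
  have hint := hg.integrable_sub_mean_mul hDo hDn hDb hf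
  set η : Lp ℝ 2 P := ∫ y in D, f y • centredField g P y with hη
  have hηint : Integrable η P := (Lp.memLp η).integrable (by norm_num)
  refine hηint.ae_eq_of_forall_setIntegral_eq _ _ hint.integral_prod_right ?_
  intro s hs _
  have hs' : P s ≠ ⊤ := measure_ne_top P s
  calc ∫ ω in s, η ω ∂P = inner ℝ (indicatorConstLp 2 hs hs' (1 : ℝ)) η := by
        rw [L2.inner_indicatorConstLp_one]
    _ = ∫ y in D, inner ℝ (indicatorConstLp 2 hs hs' (1 : ℝ)) (f y • centredField g P y) := by
        rw [hη, integral_inner (hg.integrable_smul_centredField hDo hDb hf)]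
    _ = ∫ y in D, ∫ ω in s, (g y ω - mean g P y) * f y ∂P := by
        refine setIntegral_congr_fun hDo.measurableSet fun y hy => ?_
        simp only [inner_smul_right, L2.inner_indicatorConstLp_one]
        rw [mul_comm, ← integral_mul_const]
        refine integral_congr_ae (ae_restrict_of_ae ?_)
        filter_upwards [hg.centredField_ae_eq (subset_closure hy)] with ω hω
        rw [hω]
    _ = ∫ ω in s, (∫ y in D, (g y ω - mean g P y) * f y) ∂P := by
        have hints : Integrable (Function.uncurry fun y ω => (g y ω - mean g P y) * f y)
            ((volume.restrict D).prod (P.restrict s)) :=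
          hint.mono_measure (Measure.prod_mono le_rfl Measure.restrict_le_self)
        exact integral_integral_swap hints

end CentredField

/-! ### Truncation error of the Karhunen–Loève expansion -/

section Truncation

variable {d : ℕ} {Ω : Type*} [MeasurableSpace Ω] {P : Measure Ω}
  {D : Set (EuclideanSpace ℝ (Fin d))} {g : EuclideanSpace ℝ (Fin d) → Ω → ℝ}
  {lam : ℕ → ℝ} {b : ℕ → EuclideanSpace ℝ (Fin d) → ℝ}

lemma IsLipschitzDomain.volume_ne_top (hD : IsLipschitzDomain D) : volume D ≠ ⊤ :=
  hD.isBounded.measure_lt_top.ne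

lemma IsKLEigensystem.integrableOn (hD : IsLipschitzDomain D)
    (hKL : IsKLEigensystem D g P lam b) (m : ℕ) : IntegrableOn (b m) D := by
  have : IsFiniteMeasure (volume.restrict D) := ⟨by simpa using hD.volume_ne_top.lt_top⟩
  exact (hKL.memLp m).integrable (by norm_num)

/-- The unnormalized Karhunen–Loève coefficient `∫_D b_m (g - E[g])`, which is `√λ_m ξ_m`, as an
element of `L²(P)`. -/
noncomputable def coeffVec (D : Set (EuclideanSpace ℝ (Fin d)))
    (g : EuclideanSpace ℝ (Fin d) → Ω → ℝ) (P : Measure Ω)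
    (b : ℕ → EuclideanSpace ℝ (Fin d) → ℝ) (m : ℕ) : Lp ℝ 2 P :=
  ∫ y in D, b m y • centredField g P y

variable [IsProbabilityMeasure P]

lemma IsKLEigensystem.inner_centredField_coeffVec (hD : IsLipschitzDomain D)
    (hg : IsContinuousGaussianField D g P) (hKL : IsKLEigensystem D g P lam b) (m : ℕ)
    {x : EuclideanSpace ℝ (Fin d)} (hx : x ∈ D) :
    inner ℝ (centredField g P x) (coeffVec D g P b m) = lam m * b m x := by
  rw [← hKL.eigen m x hx, coeffVec, covOp, ← integral_inner
    (hg.integrable_smul_centredField hD.isOpen hD.isBounded (hKL.integrableOn hD m))]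
  refine setIntegral_congr_fun hD.isOpen.measurableSet fun y hy => ?_
  simp only [inner_smul_right]
  rw [hg.inner_centredField (subset_closure hx) (subset_closure hy), mul_comm]

lemma IsKLEigensystem.inner_coeffVec (hD : IsLipschitzDomain D)
    (hg : IsContinuousGaussianField D g P) (hKL : IsKLEigensystem D g P lam b) (m n : ℕ) :
    inner ℝ (coeffVec D g P b m) (coeffVec D g P b n) = if m = n then lam m else 0 := by
  have h1 : inner ℝ (coeffVec D g P b m) (coeffVec D g P b n)
      = ∫ y in D, lam m * (b m y * b n y) := by
    nth_rewrite 2 [coeffVec]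
    rw [← integral_inner
      (hg.integrable_smul_centredField hD.isOpen hD.isBounded (hKL.integrableOn hD n))]
    refine setIntegral_congr_fun hD.isOpen.measurableSet fun y hy => ?_
    simp only [inner_smul_right]
    rw [real_inner_comm, hKL.inner_centredField_coeffVec hD hg m hy]
    ring
  rw [h1, integral_const_mul, hKL.orthonormal]
  split_ifs <;> simp

lemma IsKLEigensystem.centredField_mem_closure_span (hD : IsLipschitzDomain D)
    (hg : IsContinuousGaussianField D g P) (hKL : IsKLEigensystem D g P lam b)
    {x : EuclideanSpace ℝ (Fin d)} (hx : x ∈ D) :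
    centredField g P x ∈ (Submodule.span ℝ (Set.range (coeffVec D g P b))).topologicalClosure := by
  obtain ⟨B, hB⟩ := hg.exists_norm_centredField_le hD.isBounded
  refine mem_closure_span_of_exhaustive (ν := volume) hD.isOpen hD.volume_ne_top
    (hg.continuousOn_centredField.mono subset_closure) (fun y hy => hB y (subset_closure hy))
    (hKL.integrableOn hD) (fun m y hy => hKL.inner_centredField_coeffVec hD hg m hy) ?_ x hx
  intro μ f hμ hf heig horth
  refine hKL.exhaustive μ f hμ hf ?_ horth
  filter_upwards [ae_restrict_mem hD.isOpen.measurableSet] with y hy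
  rw [← heig y hy, covOp]
  refine setIntegral_congr_fun hD.isOpen.measurableSet fun z hz => ?_
  rw [hg.inner_centredField (subset_closure hy) (subset_closure hz)]

/-- The remainder after `M` terms of the Karhunen–Loève expansion, as an element of `L²(P)`. -/
noncomputable def remainder (D : Set (EuclideanSpace ℝ (Fin d)))
    (g : EuclideanSpace ℝ (Fin d) → Ω → ℝ) (P : Measure Ω)
    (b : ℕ → EuclideanSpace ℝ (Fin d) → ℝ) (M : ℕ) (x : EuclideanSpace ℝ (Fin d)) : Lp ℝ 2 P :=
  centredField g P x - ∑ m ∈ Finset.range M, b m x • coeffVec D g P b m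

lemma IsKLEigensystem.enorm_remainder_sq_le (hD : IsLipschitzDomain D)
    (hg : IsContinuousGaussianField D g P) (hKL : IsKLEigensystem D g P lam b)
    (hB1 : AssumptionB1 D b) (β : ℝ) (M : ℕ) {x : EuclideanSpace ℝ (Fin d)} (hx : x ∈ D) :
    ‖remainder D g P b M x‖ₑ ^ 2 ≤ tailMax D lam b β M := by
  refine (enorm_sub_sum_sq_le_tsum (hKL.inner_coeffVec hD hg)
    (hKL.centredField_mem_closure_span hD hg hx) (c := fun m => b m x)
    (fun m => hKL.inner_centredField_coeffVec hD hg m hx) M).trans ?_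
  refine le_trans (ENNReal.tsum_le_tsum fun m => ?_) (le_max_left _ _)
  rw [supTerm]
  gcongr
  exact enorm_le_eLpNorm_top_of_continuousOn hD.isOpen (hB1 _).1.continuousOn hx

lemma IsKLEigensystem.enorm_remainder_sub_sq_le (hD : IsLipschitzDomain D)
    (hg : IsContinuousGaussianField D g P) (hKL : IsKLEigensystem D g P lam b)
    (M : ℕ) {x y : EuclideanSpace ℝ (Fin d)} (hx : x ∈ D) (hy : y ∈ D) :
    ‖remainder D g P b M x - remainder D g P b M y‖ₑ ^ 2 ≤
      ∑' m, ENNReal.ofReal (lam (m + M)) * ‖b (m + M) x - b (m + M) y‖ₑ ^ 2 := by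
  have h := enorm_sub_sum_sq_le_tsum (hKL.inner_coeffVec hD hg)
    (Submodule.sub_mem _ (hKL.centredField_mem_closure_span hD hg hx)
      (hKL.centredField_mem_closure_span hD hg hy)) (c := fun m => b m x - b m y)
    (fun m => by
      rw [inner_sub_left, hKL.inner_centredField_coeffVec hD hg m hx,
        hKL.inner_centredField_coeffVec hD hg m hy]
      ring) M
  have heq : remainder D g P b M x - remainder D g P b M y
      = centredField g P x - centredField g P y -
        ∑ m ∈ Finset.range M, (b m x - b m y) • coeffVec D g P b m := by
    simp only [remainder, sub_smul, Finset.sum_sub_distrib]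
    abel
  rwa [heq]

omit [IsProbabilityMeasure P] in
lemma coeffVec_mem_closure_span (hD : IsLipschitzDomain D) (m : ℕ) :
    coeffVec D g P b m ∈ (Submodule.span ℝ
      (Set.range fun x : closure D => centredField g P x)).topologicalClosure := by
  have : IsFiniteMeasure (volume.restrict D) := ⟨by simpa using hD.volume_ne_top.lt_top⟩
  refine integral_mem_of_isClosed (Submodule.isClosed_topologicalClosure _) ?_
  filter_upwards [ae_restrict_mem hD.isOpen.measurableSet] with y hy
  exact Submodule.smul_mem _ _ (Submodule.le_topologicalClosure _
    (Submodule.subset_span ⟨⟨y, subset_closure hy⟩, rfl⟩))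

omit [IsProbabilityMeasure P] in
lemma remainder_mem_closure_span (hD : IsLipschitzDomain D) (M : ℕ)
    {x : EuclideanSpace ℝ (Fin d)} (hx : x ∈ D) :
    remainder D g P b M x ∈ (Submodule.span ℝ
      (Set.range fun x : closure D => centredField g P x)).topologicalClosure := by
  refine Submodule.sub_mem _ (Submodule.le_topologicalClosure _
    (Submodule.subset_span ⟨⟨x, subset_closure hx⟩, rfl⟩)) ?_
  exact Submodule.sum_mem _ fun m _ => Submodule.smul_mem _ _ (coeffVec_mem_closure_span hD m)

/-- The case `λ_m = 0` is included: then `√λ_m ξ_m` is zero by the convention for division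
by zero, and the integral of the field against `b_m` vanishes almost surely. -/
lemma IsKLEigensystem.sqrt_mul_klCoeff_ae_eq (hD : IsLipschitzDomain D)
    (hg : IsContinuousGaussianField D g P) (hKL : IsKLEigensystem D g P lam b) (m : ℕ) :
    (fun ω => √(lam m) * klCoeff D g P lam b m ω) =ᵐ[P] coeffVec D g P b m := by
  have hinner := hKL.inner_coeffVec hD hg m m
  rw [if_pos rfl] at hinner
  have hlam : 0 ≤ lam m := hinner ▸ real_inner_self_nonneg
  rcases hlam.eq_or_lt with h0 | hpos
  · have hz : coeffVec D g P b m = 0 := by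
      rw [← h0] at hinner
      exact inner_self_eq_zero.1 hinner
    rw [hz, ← h0]
    filter_upwards [Lp.coeFn_zero ℝ 2 P] with ω hω
    rw [hω]
    simp
  · have hs : √(lam m) ≠ 0 := (Real.sqrt_pos.2 hpos).ne'
    filter_upwards [hg.setIntegral_smul_centredField_ae_eq hD.isOpen hD.isConnected.nonempty
      hD.isBounded (hKL.integrableOn hD m)] with ω hω
    rw [klCoeff, mul_inv_cancel_left₀ hs, coeffVec, hω]

lemma IsKLEigensystem.klTrunc_sub_ae_eq (hD : IsLipschitzDomain D)
    (hg : IsContinuousGaussianField D g P) (hKL : IsKLEigensystem D g P lam b) (M : ℕ)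
    {x : EuclideanSpace ℝ (Fin d)} (hx : x ∈ closure D) :
    (fun ω => klTrunc D g P lam b M x ω - g x ω) =ᵐ[P] -remainder D g P b M x := by
  have hsum : ((∑ m ∈ Finset.range M, b m x • coeffVec D g P b m : Lp ℝ 2 P) : Ω → ℝ)
      =ᵐ[P] fun ω => ∑ m ∈ Finset.range M, √(lam m) * klCoeff D g P lam b m ω * b m x := by
    have h1 : ∀ᵐ ω ∂P, ∀ m ∈ Finset.range M, (b m x • coeffVec D g P b m : Lp ℝ 2 P) ω
        = √(lam m) * klCoeff D g P lam b m ω * b m x := by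
      rw [Filter.eventually_all_finset]
      intro m _
      filter_upwards [Lp.coeFn_smul (b m x) (coeffVec D g P b m),
        hKL.sqrt_mul_klCoeff_ae_eq hD hg m] with ω h2 h3
      rw [h2, Pi.smul_apply, ← h3, smul_eq_mul, mul_comm]
    filter_upwards [Lp.coeFn_finsetSum (Finset.range M) fun m => b m x • coeffVec D g P b m, h1]
      with ω h2 h3
    rw [h2, Finset.sum_apply]
    exact Finset.sum_congr rfl h3
  filter_upwards [Lp.coeFn_sub (centredField g P x)
    (∑ m ∈ Finset.range M, b m x • coeffVec D g P b m), hg.centredField_ae_eq hx, hsum]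
    with ω h1 h2 h3
  rw [Pi.neg_apply, remainder, h1, Pi.sub_apply, h2, h3, klTrunc]
  ring

lemma IsKLEigensystem.aemeasurable_klTrunc (hD : IsLipschitzDomain D)
    (hg : IsContinuousGaussianField D g P) (hKL : IsKLEigensystem D g P lam b) (M : ℕ)
    (x : EuclideanSpace ℝ (Fin d)) : AEMeasurable (klTrunc D g P lam b M x) P := by
  refine aemeasurable_const.add (Finset.aemeasurable_fun_sum _ fun m _ => ?_)
  exact ((Lp.aestronglyMeasurable _).aemeasurable.congr
    (hKL.sqrt_mul_klCoeff_ae_eq hD hg m).symm).mul_const _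

lemma IsContinuousGaussianField.continuousOn_klTrunc
    (hg : IsContinuousGaussianField D g P) (hB1 : AssumptionB1 D b) (M : ℕ) (ω : Ω) :
    ContinuousOn (fun x => klTrunc D g P lam b M x ω) (closure D) := by
  refine hg.continuousOn_mean.add (continuousOn_finsetSum _ fun m _ => ?_)
  exact continuousOn_const.mul (hB1 m).2

/-- The truncation error in `L^q(Ω; C⁰)`, for large `q`: Gaussianity turns the second moment bounds
for the remainder and its increments into bounds for moments of order `q`, to which chaining
applies. -/
lemma IsKLEigensystem.exists_lintegral_iSup_klTrunc_sub_le (hD : IsLipschitzDomain D)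
    (hg : IsContinuousGaussianField D g P) (hKL : IsKLEigensystem D g P lam b)
    (hB1 : AssumptionB1 D b) {β : ℝ} (hβ : β ∈ Set.Ioo (0 : ℝ) 1) (p : ℝ) :
    ∃ q : ℝ, p ≤ q ∧ 0 < q ∧ ∃ C : ℝ≥0, ∀ M,
      ∫⁻ ω, (⨆ x ∈ closure D, ‖klTrunc D g P lam b M x ω - g x ω‖ₑ) ^ q ∂P ≤
        C * tailMax D lam b β M ^ (q / 2) := by
  obtain ⟨q₀, hq₀⟩ := exists_forall_lintegral_iSup_rpow_le P hD.isBounded hβ.1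
  obtain ⟨C₁, hC₁⟩ := hD.exists_tsum_enorm_sub_sq_le hβ
  set q : ℝ := max (max p q₀) 1 with hq
  have hq0 : 0 < q := lt_of_lt_of_le one_pos (le_max_right _ _)
  have hqp : p ≤ q := (le_max_left _ _).trans (le_max_left _ _)
  obtain ⟨C₂, hC₂⟩ := hq₀ q ((le_max_right _ _).trans (le_max_left _ _)) hq0
  obtain ⟨c, hc⟩ := exists_eLpNorm_le_of_mem_closure_span P (q := ENNReal.ofReal q) (by simp)
  -- passage from second moments to moments of order `q`
  have hmoment : ∀ (Z : Lp ℝ 2 P) (f : Ω → ℝ) (T : ℝ≥0∞), Z ∈ (Submodule.span ℝ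
      (Set.range fun x : closure D => centredField g P x)).topologicalClosure →
      f =ᵐ[P] Z → ‖Z‖ₑ ^ 2 ≤ T → ∫⁻ ω, ‖f ω‖ₑ ^ q ∂P ≤ (c : ℝ≥0∞) ^ q * T ^ (q / 2) := by
    intro Z f T hZ hf hT
    have h1 := hc (fun (x : closure D) => g x) hg.gaussian (fun x : closure D => centredField g P x)
      (fun x => hg.centredField_ae_eq x.2) Z hZ
    have h2 : ∫⁻ ω, ‖f ω‖ₑ ^ q ∂P = eLpNorm Z (ENNReal.ofReal q) P ^ q := by
      rw [← eLpNorm_congr_ae hf, eLpNorm_eq_lintegral_rpow_enorm_toReal (by simpa using hq0)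
        (by simp), ENNReal.toReal_ofReal hq0.le, ← ENNReal.rpow_mul, one_div_mul_cancel hq0.ne',
        ENNReal.rpow_one]
    rw [h2]
    calc eLpNorm Z (ENNReal.ofReal q) P ^ q ≤ (c * ‖Z‖ₑ) ^ q := by gcongr
      _ = (c : ℝ≥0∞) ^ q * (‖Z‖ₑ ^ 2) ^ (q / 2) := by
          rw [ENNReal.mul_rpow_of_nonneg _ _ hq0.le, ← ENNReal.rpow_two, ← ENNReal.rpow_mul]
          congr 2; ring
      _ ≤ _ := by gcongr
  set K : ℝ≥0 := max 1 C₁ with hK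
  refine ⟨q, hqp, hq0, C₂ * (c ^ q * K ^ (q / 2)), fun M => ?_⟩
  set T := tailMax D lam b β M with hT
  have hae : ∀ x ∈ closure D, (fun ω => klTrunc D g P lam b M x ω - g x ω) =ᵐ[P]
      (-remainder D g P b M x : Lp ℝ 2 P) := fun x hx =>
    (hKL.klTrunc_sub_ae_eq hD hg M hx).trans (Lp.coeFn_neg _).symm
  have hmain := hC₂ (fun x ω => klTrunc D g P lam b M x ω - g x ω)
    ((c : ℝ≥0∞) ^ q * (K * T) ^ (q / 2)) ?_ ?_ ?_ ?_
  · refine hmain.trans (le_of_eq ?_)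
    rw [ENNReal.mul_rpow_of_nonneg _ _ (by positivity), ENNReal.coe_mul, ENNReal.coe_mul,
      ENNReal.coe_rpow_of_nonneg _ hq0.le, ENNReal.coe_rpow_of_nonneg _ (by positivity)]
    ring
  · intro x hx
    exact (hKL.aemeasurable_klTrunc hD hg M x).sub
      (hg.hasGaussianLaw (subset_closure hx)).aemeasurable
  · filter_upwards [hg.continuous_paths] with ω hω
    exact (hg.continuousOn_klTrunc hB1 M ω).sub hω
  · intro x hx
    refine hmoment _ _ _ (Submodule.neg_mem _ (remainder_mem_closure_span hD M hx))
      (hae x (subset_closure hx)) ?_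
    rw [enorm_neg]
    refine (hKL.enorm_remainder_sq_le hD hg hB1 β M hx).trans ?_
    refine le_mul_of_one_le_left zero_le ?_
    exact_mod_cast le_max_left 1 C₁
  · intro x hx y hy
    have hae2 : (fun ω => (klTrunc D g P lam b M x ω - g x ω) - (klTrunc D g P lam b M y ω - g y ω))
        =ᵐ[P] (-(remainder D g P b M x - remainder D g P b M y) : Lp ℝ 2 P) := by
      have h1 : (-(remainder D g P b M x - remainder D g P b M y) : Lp ℝ 2 P)
          = -remainder D g P b M x - -remainder D g P b M y := by abel
      rw [h1]
      exact ((hae x (subset_closure hx)).sub (hae y (subset_closure hy))).trans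
        (Lp.coeFn_sub _ _).symm
    refine (hmoment _ _ (K * T * edist x y ^ (2 * β)) (Submodule.neg_mem _ (Submodule.sub_mem _
      (remainder_mem_closure_span hD M hx) (remainder_mem_closure_span hD M hy))) hae2 ?_).trans
      (le_of_eq ?_)
    · rw [enorm_neg]
      refine (hKL.enorm_remainder_sub_sq_le hD hg M hx hy).trans
        ((hC₁ lam b hB1 M x hx y hy).trans ?_)
      gcongr
      exact le_max_right _ _
    · rw [ENNReal.mul_rpow_of_nonneg (K * T) _ (by positivity), ← ENNReal.rpow_mul, ← mul_assoc]
      congr 2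
      ring

end Truncation

/-! ### The transformed field -/

section Transformed

lemma lipschitzWith_transform {φ : ℝ} (hφ : 0 ≤ φ) {a : ℝ → ℝ} {K : ℝ≥0} (ha : LipschitzWith K a) :
    LipschitzWith (φ.toNNReal + K) (transform φ a) := by
  have hsig : LipschitzWith 1 Real.sigmoid := by
    refine lipschitzWith_of_nnnorm_deriv_le differentiable_sigmoid fun t => ?_
    rw [← NNReal.coe_le_coe, coe_nnnorm, Real.deriv_sigmoid]
    have h0 := Real.sigmoid_nonneg t
    have h1 := Real.sigmoid_le_one t
    rw [Real.norm_of_nonneg (mul_nonneg h0 (by linarith))]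
    push_cast
    nlinarith
  have heq : transform φ a = fun t => φ * Real.sigmoid t + a t := by
    funext t
    rw [transform, Real.sigmoid_def, Real.exp_neg]
    congr 2
    have := Real.exp_pos t
    field_simp
    ring
  rw [heq]
  refine LipschitzWith.add (LipschitzWith.of_dist_le_mul fun s t => ?_) ha
  have h := hsig.dist_le_mul s t
  rw [NNReal.coe_one, one_mul] at h
  rw [Real.dist_eq, ← mul_sub, abs_mul, abs_of_nonneg hφ, Real.coe_toNNReal φ hφ, ← Real.dist_eq]
  gcongr

/-- The supremum norm of an almost surely continuous random field is measurable, being almost surely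
the supremum over a countable dense set. -/
lemma aemeasurable_cZeroNorm {d : ℕ} {Ω : Type*} [MeasurableSpace Ω] {P : Measure Ω}
    {S : Set (EuclideanSpace ℝ (Fin d))} {v : EuclideanSpace ℝ (Fin d) → Ω → ℝ}
    (hv : ∀ x ∈ S, AEMeasurable (v x) P) (hc : ∀ᵐ ω ∂P, ContinuousOn (fun x => v x ω) S) :
    AEMeasurable (fun ω => cZeroNorm S fun x => v x ω) P := by
  obtain ⟨Q, hQS, hQc, hQ⟩ :=
    (TopologicalSpace.IsSeparable.of_separableSpace S).exists_countable_dense_subset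
  have h : AEMeasurable (fun ω => ⨆ x ∈ Q, ‖v x ω‖ₑ) P :=
    AEMeasurable.biSup Q hQc fun x hx => (hv x (hQS hx)).enorm
  refine h.congr ?_
  filter_upwards [hc] with ω hω
  refine le_antisymm (biSup_mono hQS) (iSup₂_le fun x hx => ?_)
  have hcl : x ∈ closure Q := hQ hx
  have : Filter.NeBot (nhdsWithin x Q) := mem_closure_iff_nhdsWithin_neBot.1 hcl
  have hlim : Filter.Tendsto (fun y => ‖v y ω‖ₑ) (nhdsWithin x Q) (nhds ‖v x ω‖ₑ) :=
    (continuous_enorm.tendsto _).comp ((hω x hx).mono hQS)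
  refine le_of_tendsto hlim ?_
  filter_upwards [self_mem_nhdsWithin] with y hy
  exact le_iSup₂ (f := fun y (_ : y ∈ Q) => ‖v y ω‖ₑ) y hy

end Transformed

end KLField

theorem mainTheorem5 {d : ℕ} (D : Set (EuclideanSpace ℝ (Fin d)))
    (hD : KLField.IsLipschitzDomain D)
    {Ω : Type*} [MeasurableSpace Ω] (P : Measure Ω) [IsProbabilityMeasure P]
    (g : EuclideanSpace ℝ (Fin d) → Ω → ℝ)
    (hg : KLField.IsContinuousGaussianField D g P)
    (lam : ℕ → ℝ) (b : ℕ → EuclideanSpace ℝ (Fin d) → ℝ)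
    (hKL : KLField.IsKLEigensystem D g P lam b)
    (hB1 : KLField.AssumptionB1 D b)
    (hB2 : KLField.AssumptionB2 D lam b)
    (hB3 : KLField.AssumptionB3 D lam b)
    (a : ℝ → ℝ) (K : ℝ≥0) (ha : LipschitzWith K a)
    (φ p β : ℝ) (hφ : 0 < φ) (hp : 0 < p) (hβ : β ∈ Set.Ioo (0 : ℝ) 1) :
    ∃ c : ℝ≥0, ∀ M : ℕ,
      AEMeasurable (fun ω => KLField.cZeroNorm (closure D) (fun x =>
        KLField.transform φ a (KLField.klTrunc D g P lam b M x ω) -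
          KLField.transform φ a (g x ω))) P ∧
      KLField.lpCZeroNorm p P (closure D) (fun x ω =>
        KLField.transform φ a (KLField.klTrunc D g P lam b M x ω) -
          KLField.transform φ a (g x ω)) ≤
        c * KLField.tailMax D lam b β M ^ (1 / 2 : ℝ) := by
  obtain ⟨q, hpq, hq0, C, hC⟩ := hKL.exists_lintegral_iSup_klTrunc_sub_le hD hg hB1 hβ p
  have hlip := KLField.lipschitzWith_transform hφ.le ha
  set L : ℝ≥0 := φ.toNNReal + K with hL
  refine ⟨L * C ^ (1 / q), fun M => ?_⟩
  set F : Ω → ℝ≥0∞ := fun ω => KLField.cZeroNorm (closure D) (fun x =>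
    KLField.transform φ a (KLField.klTrunc D g P lam b M x ω) -
      KLField.transform φ a (g x ω)) with hF
  have hmeas : AEMeasurable F P := by
    refine KLField.aemeasurable_cZeroNorm (fun x hx => ?_) ?_
    · exact (hlip.continuous.measurable.comp_aemeasurable
        (hKL.aemeasurable_klTrunc hD hg M x)).sub
        (hlip.continuous.measurable.comp_aemeasurable (hg.hasGaussianLaw hx).aemeasurable)
    · filter_upwards [hg.continuous_paths] with ω hω
      exact (hlip.continuous.comp_continuousOn (hg.continuousOn_klTrunc hB1 M ω)).sub
        (hlip.continuous.comp_continuousOn hω)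
  refine ⟨hmeas, ?_⟩
  have hFle : ∀ ω, F ω ≤ L * ⨆ x ∈ closure D, ‖KLField.klTrunc D g P lam b M x ω - g x ω‖ₑ := by
    intro ω
    refine iSup₂_le fun x hx => ?_
    rw [← edist_eq_enorm_sub]
    refine (hlip _ _).trans ?_
    rw [edist_eq_enorm_sub]
    gcongr
    exact le_iSup₂ (f := fun x (_ : x ∈ closure D) => ‖KLField.klTrunc D g P lam b M x ω - g x ω‖ₑ)
      x hx
  have hmono : (∫⁻ ω, F ω ^ p ∂P) ^ (1 / p) ≤ (∫⁻ ω, F ω ^ q ∂P) ^ (1 / q) := by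
    have := eLpNorm'_le_eLpNorm'_of_exponent_le hp hpq P hmeas.aestronglyMeasurable
    simpa [eLpNorm'] using this
  calc KLField.lpCZeroNorm p P (closure D) _ = (∫⁻ ω, F ω ^ p ∂P) ^ (1 / p) := rfl
    _ ≤ (∫⁻ ω, F ω ^ q ∂P) ^ (1 / q) := hmono
    _ ≤ ((L : ℝ≥0∞) ^ q * (C * KLField.tailMax D lam b β M ^ (q / 2))) ^ (1 / q) := by
        gcongr
        calc ∫⁻ ω, F ω ^ q ∂P ≤ ∫⁻ ω, (L : ℝ≥0∞) ^ q *
              (⨆ x ∈ closure D, ‖KLField.klTrunc D g P lam b M x ω - g x ω‖ₑ) ^ q ∂P := by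
              refine lintegral_mono fun ω => ?_
              rw [← ENNReal.mul_rpow_of_nonneg _ _ hq0.le]
              gcongr
              exact hFle ω
          _ ≤ _ := by
              rw [lintegral_const_mul' _ _
                (ENNReal.rpow_ne_top_of_nonneg hq0.le ENNReal.coe_ne_top)]
              gcongr
              exact hC M
    _ = _ := by
        have hq' : 0 ≤ 1 / q := by positivity
        rw [ENNReal.mul_rpow_of_nonneg _ _ hq', ENNReal.mul_rpow_of_nonneg _ _ hq',
          ← ENNReal.rpow_mul, ← ENNReal.rpow_mul, mul_one_div_cancel hq0.ne', ENNReal.rpow_one,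
          ENNReal.coe_mul, ENNReal.coe_rpow_of_nonneg _ hq', mul_assoc]
        congr 3
        field_simp
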